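/- **Setting.** Let $S^{d-1}=\{x\in\mathbb R^d:\|x\|_2=1\}$. Let $b_0,b_1,\dots$ be the coefficients of a *slowly decaying* kernel $K(x,x')=\sum_{k\ge0}b_k\,(x\cdot x')^k$ on the sphere, i.e. $\sum_k b_k<\infty$ and, for some $c>0$, $b_0\ge c$ and $b_k\ge c\,k^{-2}$ for all $k\ge1$. Let $\Lambda$ be a real number and let $L(y,\hat y)$ be a measurable loss function with values in $[0,\Lambda]$ that is 1-Lipschitz in the prediction $\hat y$ and satisfies $L(y,y)=0$. For a learning algorithm, a function $g$ on $S^{d-1}$, a probability distribution $\mathcal D$ on $S^{d-1}$, and $\epsilon>0$, $\delta\in(0,1)$, the sample complexity $n_{g,\mathcal D}(\epsilon,\delta)$ is the smallest integer $n$ such that the algorithm, given $n$ i.i.d. examples $(x,g(x))$ with $x\sim\mathcal D$, produces with probability greater than $1-\delta$ a model $\hat g$ with $\mathbb E_{x\sim\mathcal D}[L(g(x),\hat g(x))]<\epsilon$. The function $g$ is *efficiently learned* with respect to a constant $C>0$, with parameter $M_g$, if $n_{g,\mathcal D}(\epsilon,\delta)\le C\,(M_g+\log(1/\delta))/\epsilon^2$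 for all $\epsilon>0$, all $\delta\in(0,1)$ and all $\mathcal D$. Two kinds of algorithm are considered. (i) *Kernel learning with $K$*: $\hat g(x)=\sum_i\alpha_iK(x_i,x)$ with $\alpha=H^{+}y$, where $H_{ij}=K(x_i,x_j)$, $y_i=g(x_i)$, and $H^+$ is the Moore–Penrose pseudoinverse. (ii) *Wide one-hidden-layer networks with kernel $K$*: the model is $\hat g(x)=\sum_{j=1}^m u_j\,\varphi(w_j,x)/\sqrt m$, where the lower-layer weights $w_j$ are drawn independently from a probability measure and then frozen, $\varphi$ is jointly measurable with $\varphi(\cdot,x)$ square integrable for every $x$, and $\mathbb E_w[\varphi(w,x)\varphi(w,x')]=K(x,x')$ for all $x,x'\in S^{d-1}$; the final-layer weights $u$ are trained by stochastic gradient descent from $u=0$ on the squared loss, each step using one example chosen uniformly at random. In (ii) the probability is taken also over the $w_j$ and over the random choices of SGD, and "with $n$ examples the algorithm succeeds" means that it does so for all sufficiently large widths $m$, then all sufficiently small learning rates $\eta>0$ (depending on $m$), then all sufficiently long training times (depending on $m$ and $\eta$; the training time is a multiple of $n$ steps); how large, small and long may also depend on $g,\mathcal D,\epsilon,\delta,n$.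 **Theorem.** For each slowly decaying coefficient sequence $(b_k)$ and each $\Lambda$ there is a constant $C>0$ such that the following holds for every loss $L$ as above, every $d$, and every function on $S^{d-1}$ with a power series representation $$g(x)=\sum_{k\ge0}\ \sum_{v\in V_k}a_v\prod_{i=1}^{k}(\beta_{v,i}\cdot x),\qquad a_v\in\mathbb R,\ \beta_{v,i}\in\mathbb R^d,$$ where $V_k$ indexes the terms of order $k$. Let $$\tilde g(y)=\sum_{k\ge0}\tilde a_k\,y^k,\qquad \tilde a_k=\sum_{v\in V_k}|a_v|\prod_{i=1}^k\|\beta_{v,i}\|_2 .$$ If all $\tilde a_k$ are finite, the series of $\tilde g$ converges at $y=1$, and the (one-sided) derivative $\tilde g'(1)$ exists and is finite, then $g$ is efficiently learned with respect to $C$, with $$\sqrt{M_g}=\tilde g'(1)+\tilde g(0),$$ both by kernel learning with $K$ and by wide one-hidden-layer networks with kernel $K$ whose final layer is trained by SGD. -/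

import Mathlib

open MeasureTheory Filter Topology
open scoped ENNReal Matrix

noncomputable section

namespace SphereLearning

/-! ### Learning algorithms and efficient learnability -/

/-- A (possibly randomized) learning algorithm for real-valued functions on `X`. Given `n` labelled
examples and an internal random seed drawn from the probability law `law n`, independently of the
examples, it outputs a trained model `X → ℝ`. -/
structure Learner (X : Type*) where
  Seed : ℕ → Type*
  [seedMeasurable : ∀ n, MeasurableSpace (Seed n)]
  law : ∀ n, Measure (Seed n)
  law_prob : ∀ n, IsProbabilityMeasure (law n)
  train : ∀ n, (Fin n → X × ℝ) → Seed n → X → ℝ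

attribute [instance] Learner.seedMeasurable Learner.law_prob

section Learnability

variable {X : Type*} [MeasurableSpace X]

/-- The generalization error `E_{x ∼ D} [L (g x, ĝ x)]`, as a number in `[0, ∞]`
(`L` is used for nonnegative losses only). -/
def genError (L : ℝ → ℝ → ℝ) (D : Measure X) (g gHat : X → ℝ) : ℝ≥0∞ :=
  ∫⁻ x, ENNReal.ofReal (L (g x) (gHat x)) ∂D

/-- The probability, over `n` i.i.d. examples `(x, g x)`, `x ∼ D`, and over the internal randomness
of the algorithm, that the generalization error of the trained model is *not* less than `ε`. -/
def failureProb (A : Learner X) (L : ℝ → ℝ → ℝ) (g : X → ℝ) (D : Measure X) (ε : ℝ) (n : ℕ) :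
    ℝ≥0∞ :=
  ((Measure.pi fun _ : Fin n => D).prod (A.law n))
    {p | ¬ genError L D g (A.train n (fun i => (p.1 i, g (p.1 i))) p.2) < ENNReal.ofReal ε}

variable {ι : Type*}

/-- The sample complexity: the smallest number `n` of i.i.d. examples (and `⊤` if there is none)
with which the algorithm outputs, with probability greater than `1 - δ`, a model of generalization
error less than `ε`.

The algorithm may have tunable parameters `i : ι` (such as width, learning rate and training time);
these are taken sufficiently far along the filter `l`. For an algorithm without parameters take
`ι = Unit`, `l = pure ()`. -/
def sampleComplexity (l : Filter ι) (A : ι → Learner X) (L : ℝ → ℝ → ℝ) (g : X → ℝ)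
    (D : Measure X) (ε δ : ℝ) : ℕ∞ :=
  sInf {N : ℕ∞ | ∃ n : ℕ, N = n ∧ ∀ᶠ i in l, failureProb (A i) L g D ε n < ENNReal.ofReal δ}

/-- `g` is efficiently learned with respect to the constant `C`, with complexity parameter `M`:
for all `ε`, `δ` and all input distributions `D`, the sample complexity is at most
`C * (M + log (1 / δ)) / ε ^ 2`. -/
def EfficientlyLearned (l : Filter ι) (A : ι → Learner X) (L : ℝ → ℝ → ℝ) (C : ℝ) (g : X → ℝ)
    (M : ℝ) : Prop :=
  ∀ ε δ : ℝ, 0 < ε → 0 < δ → δ < 1 → ∀ D : Measure X, IsProbabilityMeasure D →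
    (sampleComplexity l A L g D ε δ : ℝ≥0∞) ≤
      ENNReal.ofReal (C * (M + Real.log δ⁻¹) / ε ^ 2)

end Learnability

/-- Loss functions `L (target) (prediction)` that are 1-Lipschitz in the prediction, vanish on
correct predictions, and take values in `[0, Λ]`. -/
structure IsBoundedLipschitzLoss (L : ℝ → ℝ → ℝ) (Λ : ℝ) : Prop where
  measurable : Measurable (Function.uncurry L)
  lipschitz : ∀ y, LipschitzWith 1 (L y)
  self_eq_zero : ∀ y, L y y = 0
  nonneg : ∀ y z, 0 ≤ L y z
  le_bound : ∀ y z, L y z ≤ Λ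

/-! ### Dot product kernels on the unit sphere -/

/-- The unit sphere of `ℝ^d`. -/
abbrev USphere (d : ℕ) : Type := Metric.sphere (0 : EuclideanSpace ℝ (Fin d)) 1

/-- The kernel `K(x, x') = ∑ b_k (x ⬝ x')^k`. -/
def dotKernel (b : ℕ → ℝ) {d : ℕ} (x x' : USphere d) : ℝ :=
  ∑' k, b k * (inner ℝ (x : EuclideanSpace ℝ (Fin d)) (x' : EuclideanSpace ℝ (Fin d))) ^ k

/-- Slowly decaying kernels: the kernel series converges on the sphere, and `b_k ≥ c k^{-2}`
for some `c > 0`; for `k = 0` this is read as `b_0 ≥ c`. -/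
def SlowlyDecaying (b : ℕ → ℝ) : Prop :=
  Summable b ∧ ∃ c > 0, ∀ k : ℕ, c / (max (k : ℝ) 1) ^ 2 ≤ b k

/-- The Moore-Penrose pseudoinverse of a symmetric real matrix: apply `t ↦ t⁻¹`, with `0⁻¹ = 0`,
to the eigenvalues. -/
def symmPinv {n : ℕ} (H : Matrix (Fin n) (Fin n) ℝ) : Matrix (Fin n) (Fin n) ℝ :=
  cfc (fun t : ℝ => t⁻¹) H

/-- Kernel learning with kernel `K`: the kernel regression function
`x ↦ ∑ i, α i * K(x_i, x)`, `α = H⁺ y`, where `H` is the Gram matrix of the examples and `y` the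
vector of labels. This is the least-norm interpolant of the examples in the reproducing kernel
Hilbert space of `K` (least-norm least-squares fit, if the examples cannot be interpolated). -/
def kernelLearner {X : Type*} (K : X → X → ℝ) : Learner X where
  Seed _ := Unit
  law _ := Measure.dirac ()
  law_prob _ := inferInstance
  train n data _ x :=
    ∑ i : Fin n,
      (symmPinv (Matrix.of fun i j : Fin n => K (data i).1 (data j).1) *ᵥ fun j => (data j).2) i *
        K (data i).1 x

/-! ### Wide one-hidden-layer networks whose final layer is trained by SGD -/

section Network

variable {X W : Type*}

/-- The vector of activations of a hidden layer with `m` units, on the input `x`. A hidden unit with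
lower-layer weights `w : W` computes `φ w x`, for instance `σ (⟪w, x⟫)` or, with a bias `β`,
`σ (⟪w, x⟫ + β)`; the activations are normalized by `1 / √m`. -/
def hiddenLayer (φ : W → X → ℝ) {m : ℕ} (w : Fin m → W) (x : X) : Fin m → ℝ :=
  fun j => φ (w j) x / √m

/-- One step of stochastic gradient descent for the final-layer weights `u`, on the squared loss
`(u ⬝ h - y)^2 / 2` of one example with hidden activations `h` and label `y`, with learning
rate `η`. -/
def sgdStep {m : ℕ} (η : ℝ) (u h : Fin m → ℝ) (y : ℝ) : Fin m → ℝ :=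
  u - (η * (u ⬝ᵥ h - y)) • h

/-- The final-layer weights after SGD from zero, which visits the examples in the order
`idx 0, idx 1, …`. -/
def sgdWeights (φ : W → X → ℝ) {m n T : ℕ} (η : ℝ) (w : Fin m → W) (data : Fin n → X × ℝ)
    (idx : Fin T → Fin n) : Fin m → ℝ :=
  (List.ofFn idx).foldl
    (fun u i => sgdStep η u (hiddenLayer φ w (data i).1) (data i).2) 0

instance sgdIndexNonempty (q n : ℕ) : Nonempty (Fin (q * n) → Fin n) := by
  rcases Nat.eq_zero_or_pos n with h | h
  · subst h
    exact ⟨fun i => i⟩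
  · exact ⟨fun _ => ⟨0, h⟩⟩

/-- A network with one hidden layer of width `m`. The lower-layer weights of the hidden units are
drawn independently from `μ` and are then frozen; only the final layer is trained, by SGD from
zero, with learning rate `η`, for `q * n` steps (`n` being the number of examples), each on an
example that is chosen uniformly at random, independently of everything else.
The parameters are `(m, η, q)`. -/
def networkLearner [MeasurableSpace W] (μ : Measure W) [IsProbabilityMeasure μ] (φ : W → X → ℝ)
    (i : ℕ × ℝ × ℕ) : Learner X where
  Seed n := (Fin i.1 → W) × (Fin (i.2.2 * n) → Fin n)
  law n := (Measure.pi fun _ : Fin i.1 => μ).prod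
    (PMF.uniformOfFintype (Fin (i.2.2 * n) → Fin n)).toMeasure
  law_prob _ := inferInstance
  train _ data seed x := sgdWeights φ i.2.1 seed.1 data seed.2 ⬝ᵥ hiddenLayer φ seed.1 x

/-- "Sufficiently large width `m`, then sufficiently small learning rate `η > 0`, then sufficiently
long training `q`". -/
def wideNetworkFilter : Filter (ℕ × ℝ × ℕ) :=
  (atTop : Filter ℕ).curry ((𝓝[>] (0 : ℝ)).curry (atTop : Filter ℕ))

/-- The random hidden units `φ w`, `w ∼ μ`, are measurable and square integrable, and their kernel
`E_w [φ w x * φ w x']` is `K` (so that the Gram matrix of `K` is `E [h hᵀ]`). -/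
structure HasNNGPKernel [MeasurableSpace X] [MeasurableSpace W] (μ : Measure W) (φ : W → X → ℝ)
    (K : X → X → ℝ) : Prop where
  measurable : Measurable (Function.uncurry φ)
  memLp : ∀ x, MemLp (fun w => φ w x) 2 μ
  kernel_eq : ∀ x x', ∫ w, φ w x * φ w x' ∂μ = K x x'

end Network

/-! ### Multivariate power series in products of linear forms -/

/-- The data of a multivariate power series `∑ k, ∑ v ∈ V k, a v * ∏ i < k, (β v i ⬝ x)`. -/
structure LinearFormSeries (d : ℕ) where
  V : ℕ → Type*
  a : ∀ k, V k → ℝ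
  β : ∀ k, V k → Fin k → EuclideanSpace ℝ (Fin d)

namespace LinearFormSeries

variable {d : ℕ} (S : LinearFormSeries d)

/-- The function represented by the power series, on the unit sphere. -/
def onSphere (x : USphere d) : ℝ :=
  ∑' k, ∑' v : S.V k, S.a k v * ∏ i, inner ℝ (S.β k v i) (x : EuclideanSpace ℝ (Fin d))

/-- `|a v| * ∏ i, ‖β v i‖`. -/
def termNorm (k : ℕ) (v : S.V k) : ℝ := |S.a k v| * ∏ i, ‖S.β k v i‖

/-- The coefficients of the auxiliary function: `∑ v ∈ V k, |a v| * ∏ i, ‖β v i‖`. -/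
def tildeCoeff (k : ℕ) : ℝ := ∑' v : S.V k, S.termNorm k v

/-- The auxiliary function `y ↦ ∑ k, tildeCoeff k * y^k`. -/
def tilde (y : ℝ) : ℝ := ∑' k, S.tildeCoeff k * y ^ k

/-- The power series of the auxiliary function has finite coefficients and converges at `1`. -/
def TildeConvergesAtOne : Prop :=
  (∀ k, Summable (S.termNorm k)) ∧ Summable fun k => S.tildeCoeff k * (1 : ℝ) ^ k

/-- The derivative at `1` of the auxiliary function, from the left: `1` may be an end point of its
interval of convergence. -/
def tildeDerivOne : ℝ := derivWithin S.tilde (Set.Icc 0 1) 1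

end LinearFormSeries

end SphereLearning

end

open SphereLearning

/-!
Put `Q = g̃'(1) + g̃(0)`. The kernel `∑ b_k (x ⬝ x')^k` has the feature map
`x ↦ (√b_k x^{⊗k})_k` into the square summable sequences of tensors, and a power series
`g(x) = ∑ a_v ∏ (β_{v,i} ⬝ x)` is the linear functional of the features whose component of order `k`
is `b_k^{-1/2} ∑ a_v β_{v,1} ⊗ ⋯ ⊗ β_{v,k}`. As `b_k ≥ c k^{-2}`, this component has norm at most
`max k 1 * ã_k / √c`; the sum over `k` is at most `Q / √c`, because the difference quotients of `g̃`
at `1` dominate those of its partial sums (`LinearFormSeries.exists_inner_featureMap_eq`). The same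
sum bounds `|g|` on the sphere by `Q`.

Both kinds of algorithm end, with high probability, at a linear functional of some feature map that
has norm `O(Q)` and small loss on the sample. Such a functional generalizes by uniform convergence
over a ball of functionals: symmetrization, the contraction principle for the 1-Lipschitz loss and
McDiarmid's inequality show that `n` of order `(Q² + log (1 / δ)) / ε²` is enough
(`measure_exists_lossGap_finite_le`). A countable dense set of functionals takes care of
measurability. Two details keep the constant free of additive terms. If `ε > Q`, no examples are
needed, since the zero model is good enough, and otherwise rounding `n` to an integer costs at most
a factor `2` (`efficientlyLearned_of_failureProb_lt`). If `δ ≥ 1 / 2`, where `log (1 / δ)` may be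
arbitrarily small, Markov's inequality replaces McDiarmid's.

For kernel learning, the model interpolates the sample with the least norm, which is at most that of
`g` itself (`exists_inner_eq_kernelLearner_train`).

For wide networks, the features of distinct points are linearly independent, since all `b_k` are
positive, so that the Gram matrix of the distinct sample points is nonsingular. By the law of large
numbers, the Gram matrix of the hidden layer converges to it as the width grows; hence the final
layer can interpolate the sample with weights of norm at most `R`, for any `R` larger than the norm
of `g` (`tendsto_measure_not_netInterpolates`). Once interpolation is possible, SGD with a small
learning rate decreases the distance to the interpolating weights in every step, by an amount that
is proportional to the squared error on the example of the step. So the weights keep norm at most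
`2 * R`, and the expected training errors are summable in time, thus tend to zero
(`norm_sgdVec_le`, `tendsto_measure_sgd_trainLoss`). The law of large numbers also bounds the mean
squared norm of the activations (`tendsto_measure_not_wellScaled`), and the uniform convergence
bound applies for every well-scaled lower layer
(`eventually_networkLearner_failureProb_lt`).
-/

namespace SphereLearning

/-! ### Rademacher averages -/

section Rademacher

/-- The sign `±1` encoded by a Boolean. -/
noncomputable def boolSign (s : Bool) : ℝ := if s then 1 else -1

lemma abs_boolSign (s : Bool) : |boolSign s| = 1 := by cases s <;> simp [boolSign]

lemma boolSign_not (s : Bool) : boolSign (!s) = -boolSign s := by cases s <;> simp [boolSign]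

/-- The Rademacher sum `∑ σ, sup i, ∑ k, σ k * a i k` over all sign patterns `σ`, that is, `2 ^ n`
times the Rademacher average of the set of vectors `a i`. -/
noncomputable def radSum {ι : Type*} {n : ℕ} (a : ι → Fin n → ℝ) : ℝ :=
  ∑ σ : Fin n → Bool, ⨆ i, ∑ k, boolSign (σ k) * a i k

lemma sum_fin_succ_bool {M : Type*} [AddCommMonoid M] {n : ℕ} (F : (Fin (n + 1) → Bool) → M) :
    ∑ σ, F σ = ∑ σ : Fin n → Bool, (F (Fin.cons true σ) + F (Fin.cons false σ)) := by
  rw [← (Fin.consEquiv fun _ : Fin (n + 1) => Bool).sum_comp F, Fintype.sum_prod_type,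
    Finset.sum_comm]
  simp [Fin.consEquiv]

variable {ι : Type*}

lemma le_ciSup_finite [Finite ι] (f : ι → ℝ) (i : ι) : f i ≤ ⨆ i, f i :=
  le_ciSup (Set.finite_range f).bddAbove i

lemma abs_ciSup_le [Finite ι] [Nonempty ι] {f : ι → ℝ} {C : ℝ} (h : ∀ i, |f i| ≤ C) :
    |⨆ i, f i| ≤ C :=
  let i := Classical.arbitrary ι
  abs_le.2 ⟨(abs_le.1 (h i)).1.trans (le_ciSup_finite f i), ciSup_le fun j => (abs_le.1 (h j)).2⟩

/-- The two-point case of the contraction principle. -/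
lemma ciSup_add_ciSup_contraction [Finite ι] [Nonempty ι] (p ψ a : ι → ℝ)
    (h : ∀ i j, |ψ i - ψ j| ≤ |a i - a j|) :
    (⨆ i, (p i + ψ i)) + (⨆ i, (p i - ψ i)) ≤ (⨆ i, (p i + a i)) + ⨆ i, (p i - a i) := by
  refine ciSup_add_ciSup_le fun i j => ?_
  have h1 := le_ciSup_finite (fun i => p i + a i) i
  have h2 := le_ciSup_finite (fun i => p i + a i) j
  have h3 := le_ciSup_finite (fun i => p i - a i) i
  have h4 := le_ciSup_finite (fun i => p i - a i) j
  have h5 := (le_abs_self _).trans (h i j)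
  rcases abs_cases (a i - a j) with ⟨h6, _⟩ | ⟨h6, _⟩ <;> linarith

/-- The contraction principle, with an offset `c` that makes the induction work. -/
lemma sum_ciSup_contraction [Finite ι] [Nonempty ι] : ∀ {n : ℕ} (c : ι → ℝ) (ψ a : ι → Fin n → ℝ),
    (∀ i j k, |ψ i k - ψ j k| ≤ |a i k - a j k|) →
    ∑ σ : Fin n → Bool, ⨆ i, (c i + ∑ k, boolSign (σ k) * ψ i k) ≤
      ∑ σ : Fin n → Bool, ⨆ i, (c i + ∑ k, boolSign (σ k) * a i k)
  | 0, c, ψ, a, _ => by simp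
  | n + 1, c, ψ, a, h => by
    have key : ∀ s : Bool, ∑ σ : Fin n → Bool, ⨆ i, (c i + (boolSign s * ψ i 0 +
          ∑ k, boolSign (σ k) * ψ i k.succ)) ≤ ∑ σ : Fin n → Bool, ⨆ i, (c i + (boolSign s * ψ i 0 +
          ∑ k, boolSign (σ k) * a i k.succ)) := fun s => by
      simpa only [add_assoc] using sum_ciSup_contraction (fun i => c i + boolSign s * ψ i 0)
        (fun i k => ψ i k.succ) (fun i k => a i k.succ) (fun i j k => h i j k.succ)
    simp only [sum_fin_succ_bool, Fin.sum_univ_succ, Fin.cons_zero, Fin.cons_succ]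
    refine (Finset.sum_add_distrib.le.trans (add_le_add (key true) (key false))).trans ?_
    rw [← Finset.sum_add_distrib]
    refine Finset.sum_le_sum fun σ _ => ?_
    have := ciSup_add_ciSup_contraction (fun i => c i + ∑ k, boolSign (σ k) * a i k.succ)
      (fun i => ψ i 0) (fun i => a i 0) (fun i j => h i j 0)
    convert! this using 4 <;> simp [boolSign] <;> ring

/-- The contraction principle: 1-Lipschitz functions do not increase Rademacher averages. -/
lemma radSum_contraction [Finite ι] [Nonempty ι] {n : ℕ} (ψ a : ι → Fin n → ℝ)
    (h : ∀ i j k, |ψ i k - ψ j k| ≤ |a i k - a j k|) : radSum ψ ≤ radSum a := by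
  simpa [radSum] using sum_ciSup_contraction (fun _ => 0) ψ a h

variable {E : Type*} [NormedAddCommGroup E] [InnerProductSpace ℝ E]

lemma sum_norm_sq_signed_sum_aux : ∀ {n : ℕ} (p : E) (v : Fin n → E),
    ∑ σ : Fin n → Bool, ‖p + ∑ k, boolSign (σ k) • v k‖ ^ 2 = 2 ^ n * (‖p‖ ^ 2 + ∑ k, ‖v k‖ ^ 2)
  | 0, p, v => by simp
  | n + 1, p, v => by
    have key := fun s : Bool =>
      sum_norm_sq_signed_sum_aux (p + boolSign s • v 0) (fun k => v k.succ)
    simp only [sum_fin_succ_bool, Fin.sum_univ_succ, Fin.cons_zero, Fin.cons_succ, ← add_assoc,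
      Finset.sum_add_distrib, key]
    have := parallelogram_law_with_norm ℝ p (v 0)
    simp only [boolSign, if_true, one_smul, Bool.false_eq_true, if_false, neg_smul,
      ← sub_eq_add_neg, pow_succ]
    linear_combination 2 ^ n * this

lemma sum_norm_signed_sum_le {n : ℕ} (v : Fin n → E) :
    ∑ σ : Fin n → Bool, ‖∑ k, boolSign (σ k) • v k‖ ≤ 2 ^ n * √(∑ k, ‖v k‖ ^ 2) := by
  have h1 := sum_norm_sq_signed_sum_aux 0 v
  have h2 := sq_sum_le_card_mul_sum_sq (s := (Finset.univ : Finset (Fin n → Bool)))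
    (f := fun σ => ‖∑ k, boolSign (σ k) • v k‖)
  simp only [zero_add, norm_zero] at h1
  rw [h1] at h2
  refine le_of_sq_le_sq ?_ (by positivity)
  rw [mul_pow, Real.sq_sqrt (by positivity)]
  refine h2.trans (le_of_eq ?_)
  simp
  ring

/-- Rademacher sum of a ball of linear functionals, together with one more vector `y`. -/
lemma radSum_option_inner_le [Nonempty ι] {n : ℕ} {B : ℝ} {v : ι → E} (hv : ∀ i, ‖v i‖ ≤ B)
    (ψ : Fin n → E) (y : Fin n → ℝ) :
    radSum (fun (o : Option ι) k => o.elim (y k) fun i => inner ℝ (v i) (ψ k)) ≤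
      2 ^ n * (B * √(∑ k, ‖ψ k‖ ^ 2) + √(∑ k, y k ^ 2)) := by
  have hB : 0 ≤ B := (norm_nonneg _).trans (hv (Classical.arbitrary ι))
  have h1 := sum_norm_signed_sum_le ψ
  have h2 := sum_norm_signed_sum_le y
  simp only [Real.norm_eq_abs, sq_abs, smul_eq_mul] at h2
  calc _ ≤ ∑ σ : Fin n → Bool, (B * ‖∑ k, boolSign (σ k) • ψ k‖ + |∑ k, boolSign (σ k) * y k|) := by
        refine Finset.sum_le_sum fun σ _ => ciSup_le fun o => ?_
        cases o with
        | none => exact (le_abs_self _).trans (le_add_of_nonneg_left (by positivity))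
        | some i =>
          have : ∑ k, boolSign (σ k) * inner ℝ (v i) (ψ k) =
              inner ℝ (v i) (∑ k, boolSign (σ k) • ψ k) := by
            simp [inner_sum, inner_smul_right]
          simp only [Option.elim, this]
          refine (real_inner_le_norm _ _).trans (le_add_of_le_of_nonneg ?_ (abs_nonneg _))
          exact mul_le_mul_of_nonneg_right (hv i) (norm_nonneg _)
    _ ≤ _ := by
        rw [Finset.sum_add_distrib, ← Finset.mul_sum]
        nlinarith [mul_le_mul_of_nonneg_left h1 hB]

end Rademacher

/-! ### McDiarmid's bounded difference inequality -/

section McDiarmid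

open ProbabilityTheory

variable {X : Type*} [MeasurableSpace X]

lemma integrable_of_abs_le {μ : Measure X} [IsFiniteMeasure μ] {f : X → ℝ} (hf : Measurable f)
    {C : ℝ} (hC : ∀ x, |f x| ≤ C) : Integrable f μ :=
  Integrable.of_bound hf.aestronglyMeasurable C (ae_of_all _ hC)

/-- Hoeffding's lemma, for a function of oscillation at most `c`. -/
lemma integral_exp_sub_integral_le (D : Measure X) [IsProbabilityMeasure D] {c : ℝ} {F : X → ℝ}
    (hF : Measurable F) (hosc : ∀ x y, F x - F y ≤ c) (t : ℝ) :
    ∫ x, Real.exp (t * (F x - ∫ x, F x ∂D)) ∂D ≤ Real.exp (t ^ 2 * c ^ 2 / 8) := by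
  have : Nonempty X := nonempty_of_isProbabilityMeasure D
  let x₀ : X := Classical.arbitrary X
  have hbdd : BddBelow (Set.range F) := ⟨F x₀ - c, by
    rintro _ ⟨x, rfl⟩
    linarith [hosc x₀ x]⟩
  have hmem : ∀ x, F x ∈ Set.Icc (⨅ x, F x) ((⨅ x, F x) + c) := fun x =>
    ⟨ciInf_le hbdd x, by
      rw [← sub_le_iff_le_add]
      exact le_ciInf fun y => by linarith [hosc x y]⟩
  have hsub := (hasSubgaussianMGF_of_mem_Icc (μ := D) hF.aemeasurable (ae_of_all _ hmem)).mgf_le t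
  refine hsub.trans (le_of_eq ?_)
  congr 1
  simp only [add_sub_cancel_left]
  push_cast
  rw [Real.norm_eq_abs, div_pow, sq_abs]
  ring

/-- The moment generating function of a function of independent variables with differences bounded
by `c`; one variable is integrated out at a time with Hoeffding's lemma. -/
lemma integral_exp_le_of_bounded_differences (D : Measure X) [IsProbabilityMeasure D] {c K : ℝ}
    (t : ℝ) : ∀ {n : ℕ} {F : (Fin n → X) → ℝ}, Measurable F → (∀ x, |F x| ≤ K) →
    (∀ x i y, |F (Function.update x i y) - F x| ≤ c) →
    ∫ x, Real.exp (t * (F x - ∫ x, F x ∂Measure.pi fun _ => D)) ∂(Measure.pi fun _ => D) ≤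
      Real.exp (n * (t ^ 2 * c ^ 2 / 8))
  | 0, F, hF, hK, hc => by
    simp [Subsingleton.elim _ (default : Fin 0 → X)]
  | n + 1, F, hF, hK, hc => by
    set P : Measure (Fin n → X) := Measure.pi fun _ => D
    have hmp := (measurePreserving_piFinSuccAbove (fun _ : Fin (n + 1) => D) 0).symm
    set e := (MeasurableEquiv.piFinSuccAbove (fun _ : Fin (n + 1) => X) 0).symm
    have he : ∀ p, e p = Fin.cons p.1 p.2 := fun p => by
      simp [e, MeasurableEquiv.piFinSuccAbove, Fin.consEquiv]
    set G : X × (Fin n → X) → ℝ := fun p => F (e p)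
    have hG : Measurable G := hF.comp e.measurable
    have hGK : ∀ p, |G p| ≤ K := fun p => hK _
    have hGa : ∀ a, Measurable fun x => G (a, x) := fun a => hG.comp measurable_prodMk_left
    set Fb : X → ℝ := fun a => ∫ x, G (a, x) ∂P
    have hFb : Measurable Fb := hG.stronglyMeasurable.integral_prod_right.measurable
    have hFbK : ∀ a, |Fb a| ≤ K := fun a => by
      have := norm_integral_le_of_norm_le_const (μ := P) (f := fun x => G (a, x)) (C := K)
        (ae_of_all _ fun x => hGK (a, x))
      simpa using this
    have hm : ∫ x, F x ∂(Measure.pi fun _ => D) = ∫ a, Fb a ∂D := by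
      rw [← hmp.integral_comp' F]
      exact integral_prod G (integrable_of_abs_le hG hGK)
    have hosc : ∀ a b, Fb a - Fb b ≤ c := fun a b => by
      rw [← integral_sub (integrable_of_abs_le (hGa a) fun x => hGK _)
        (integrable_of_abs_le (hGa b) fun x => hGK _)]
      have hle : ∀ x, G (a, x) - G (b, x) ≤ c := fun x => by
        have := (le_abs_self _).trans (hc (Fin.cons b x) 0 a)
        simpa [G, he, Fin.update_cons_zero] using this
      calc _ ≤ ∫ _, c ∂P := integral_mono ((integrable_of_abs_le (hGa a) fun x => hGK _).sub
            (integrable_of_abs_le (hGa b) fun x => hGK _)) (integrable_const _) hle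
        _ = c := by simp
    have hexp : ∀ {Y : Type _} [MeasurableSpace Y] (μ : Measure Y) [IsProbabilityMeasure μ]
        (f : Y → ℝ) (m : ℝ), Measurable f → (∀ x, |f x| ≤ K) →
        Integrable (fun y => Real.exp (t * (f y - m))) μ := fun {Y} _ μ _ f m hf hfK => by
      refine integrable_of_abs_le (C := Real.exp (|t| * (K + |m|))) (by fun_prop) fun y => ?_
      rw [abs_of_pos (Real.exp_pos _)]
      refine Real.exp_le_exp.2 ((le_abs_self _).trans ?_)
      rw [abs_mul]
      exact mul_le_mul_of_nonneg_left ((abs_sub _ _).trans (by linarith [hfK y])) (abs_nonneg _)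
    rw [hm, ← hmp.integral_comp' (fun x => Real.exp (t * (F x - ∫ a, Fb a ∂D)))]
    change ∫ p, Real.exp (t * (G p - ∫ a, Fb a ∂D)) ∂(D.prod P) ≤ _
    rw [integral_prod _ (hexp _ _ _ hG hGK)]
    have hinner : ∀ a, ∫ x, Real.exp (t * (G (a, x) - ∫ a, Fb a ∂D)) ∂P ≤
        Real.exp (n * (t ^ 2 * c ^ 2 / 8)) * Real.exp (t * (Fb a - ∫ a, Fb a ∂D)) := fun a => by
      have hsplit : ∀ x, Real.exp (t * (G (a, x) - ∫ a, Fb a ∂D)) =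
          Real.exp (t * (G (a, x) - Fb a)) * Real.exp (t * (Fb a - ∫ a, Fb a ∂D)) := fun x => by
        rw [← Real.exp_add]; ring_nf
      simp only [hsplit]
      rw [integral_mul_const]
      refine mul_le_mul_of_nonneg_right ?_ (Real.exp_pos _).le
      refine integral_exp_le_of_bounded_differences D t (hGa a) (fun x => hGK _) fun x i y => ?_
      have := hc (Fin.cons a x) i.succ y
      simpa [G, he, ← Fin.cons_update] using this
    calc _ ≤ ∫ a, Real.exp (n * (t ^ 2 * c ^ 2 / 8)) * Real.exp (t * (Fb a - ∫ a, Fb a ∂D)) ∂D :=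
          integral_mono (hexp _ _ _ hG hGK).integral_prod_left
            ((hexp _ _ _ hFb hFbK).const_mul _) hinner
      _ ≤ Real.exp (n * (t ^ 2 * c ^ 2 / 8)) * Real.exp (t ^ 2 * c ^ 2 / 8) := by
          rw [integral_const_mul]
          exact mul_le_mul_of_nonneg_left (integral_exp_sub_integral_le D hFb hosc t)
            (Real.exp_pos _).le
      _ = _ := by
          rw [← Real.exp_add]
          push_cast
          ring_nf

/-- McDiarmid's inequality. -/
lemma measure_ge_le_of_bounded_differences (D : Measure X) [IsProbabilityMeasure D] {c K s : ℝ}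
    (hc0 : 0 < c) (hs : 0 ≤ s) {n : ℕ} (hn : 0 < n) {F : (Fin n → X) → ℝ} (hF : Measurable F)
    (hK : ∀ x, |F x| ≤ K) (hc : ∀ x i y, |F (Function.update x i y) - F x| ≤ c) :
    (Measure.pi fun _ => D).real {x | (∫ x, F x ∂Measure.pi fun _ => D) + s ≤ F x} ≤
      Real.exp (-(2 * s ^ 2 / (n * c ^ 2))) := by
  set m := ∫ x, F x ∂Measure.pi fun _ => D
  have hn' : (0 : ℝ) < n := by exact_mod_cast hn
  -- the optimal exponent in Chernoff's bound
  set t := 4 * s / (n * c ^ 2) with ht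
  have ht0 : 0 ≤ t := by positivity
  have hint : Integrable (fun x => Real.exp (t * (F x - m))) (Measure.pi fun _ => D) := by
    refine integrable_of_abs_le (C := Real.exp (t * (K + |m|))) (by fun_prop) fun x => ?_
    rw [abs_of_pos (Real.exp_pos _), Real.exp_le_exp]
    refine mul_le_mul_of_nonneg_left ?_ ht0
    linarith [le_abs_self (F x), hK x, neg_abs_le m]
  have h1 := ProbabilityTheory.measure_ge_le_exp_mul_mgf (μ := Measure.pi fun _ : Fin n => D)
    (X := fun x => F x - m) s ht0 hint
  have h2 := integral_exp_le_of_bounded_differences D t hF hK hc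
  have h3 : {x | m + s ≤ F x} = {x | s ≤ F x - m} := by
    ext x; simp only [Set.mem_ofPred_eq]; rw [le_sub_iff_add_le, add_comm]
  rw [h3]
  refine h1.trans ((mul_le_mul_of_nonneg_left h2 (Real.exp_pos _).le).trans (le_of_eq ?_))
  rw [← Real.exp_add]
  congr 1
  rw [ht]
  field_simp
  ring

end McDiarmid

/-! ### Symmetrization -/

section Symmetrization

variable {X : Type*} [MeasurableSpace X] {ι : Type*} [Finite ι] [Nonempty ι]

lemma abs_ciSup_sub_ciSup_le {ι : Type*} [Finite ι] [Nonempty ι] {f g : ι → ℝ} {C : ℝ}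
    (h : ∀ i, |f i - g i| ≤ C) : |(⨆ i, f i) - ⨆ i, g i| ≤ C := by
  rw [abs_sub_le_iff, sub_le_iff_le_add, sub_le_iff_le_add]
  constructor <;> refine ciSup_le fun i => ?_
  · linarith [le_ciSup_finite g i, (abs_le.1 (h i)).2]
  · linarith [le_ciSup_finite f i, (abs_le.1 (h i)).1]

lemma abs_sum_le_nsmul {n : ℕ} {f : Fin n → ℝ} {C : ℝ} (h : ∀ k, |f k| ≤ C) :
    |∑ k, f k| ≤ n * C := by
  refine (Finset.abs_sum_le_sum_abs _ _).trans ((Finset.sum_le_sum fun k _ => h k).trans ?_)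
  simp

lemma integral_comp_measurePreserving {Y Z : Type*} [MeasurableSpace Y] [MeasurableSpace Z]
    {μ : Measure Y} {ν : Measure Z} {f : Y → Z} (hf : MeasurePreserving f μ ν) {u : Z → ℝ}
    (hu : Measurable u) : ∫ y, u (f y) ∂μ = ∫ z, u z ∂ν := by
  rw [← hf.map_eq, integral_map hf.measurable.aemeasurable hu.aestronglyMeasurable]

/-- Symmetrization: the expected supremum of the deviations of the empirical means from the means
is at most twice a Rademacher average. The ghost sample is paired with the sample, and the sign of
a coordinate is changed by exchanging the two entries of a pair. -/
lemma integral_ciSup_deviation_le (D : Measure X) [IsProbabilityMeasure D] {l : ι → X → ℝ} {K : ℝ}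
    (hl : ∀ i, Measurable (l i)) (hK : ∀ i x, |l i x| ≤ K) (n : ℕ) :
    2 ^ n * ∫ x, (⨆ i, ∑ k, ((∫ z, l i z ∂D) - l i (x k))) ∂(Measure.pi fun _ : Fin n => D) ≤
      2 * ∫ x, radSum (fun i k => l i (x k)) ∂(Measure.pi fun _ : Fin n => D) := by
  set P : Measure (Fin n → X) := Measure.pi fun _ => D
  set P2 : Measure (Fin n → X × X) := Measure.pi fun _ => D.prod D
  have hlk : ∀ i (k : Fin n), Measurable fun x : Fin n → X => l i (x k) := fun i k =>
    (hl i).comp (measurable_pi_apply k)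
  have hmeanK : ∀ i, |∫ z, l i z ∂D| ≤ K := fun i => by
    simpa using norm_integral_le_of_norm_le_const (μ := D) (f := l i) (C := K)
      (ae_of_all _ fun x => hK i x)
  -- the doubled sample with signs `σ`
  set T : (Fin n → Bool) → (Fin n → X × X) → ℝ := fun σ z =>
    ⨆ i, ∑ k, boolSign (σ k) * (l i (z k).2 - l i (z k).1) with hT
  have hl2 : ∀ i (k : Fin n), Measurable fun z : Fin n → X × X => l i (z k).2 := fun i k =>
    (hl i).comp (measurable_snd.comp (measurable_pi_apply k))
  have hl1 : ∀ i (k : Fin n), Measurable fun z : Fin n → X × X => l i (z k).1 := fun i k =>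
    (hl i).comp (measurable_fst.comp (measurable_pi_apply k))
  have hTm : ∀ σ, Measurable (T σ) := fun σ => Measurable.iSup fun i =>
    Finset.measurable_sum _ fun k _ => ((hl2 i k).sub (hl1 i k)).const_mul _
  have hTb : ∀ σ z, |T σ z| ≤ n * (2 * K) := fun σ z => abs_ciSup_le fun i =>
    abs_sum_le_nsmul fun k => by
      rw [abs_mul, abs_boolSign, one_mul]
      exact (abs_sub _ _).trans (by linarith [hK i (z k).1, hK i (z k).2])
  -- one-sample suprema with signs
  set R : (Fin n → Bool) → (Fin n → X) → ℝ := fun σ x => ⨆ i, ∑ k, boolSign (σ k) * l i (x k)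
    with hR
  have hRm : ∀ σ, Measurable (R σ) := fun σ => Measurable.iSup fun i =>
    Finset.measurable_sum _ fun k _ => (hlk i k).const_mul _
  have hRb : ∀ σ x, |R σ x| ≤ n * K := fun σ x => abs_ciSup_le fun i =>
    abs_sum_le_nsmul fun k => by
      rw [abs_mul, abs_boolSign, one_mul]
      exact hK i _
  have hRi : ∀ σ, Integrable (R σ) P := fun σ => integrable_of_abs_le (hRm σ) (hRb σ)
  have hfst : MeasurePreserving (fun (z : Fin n → X × X) k => (z k).1) P2 P :=
    measurePreserving_pi _ _ fun _ => measurePreserving_fst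
  have hsnd : MeasurePreserving (fun (z : Fin n → X × X) k => (z k).2) P2 P :=
    measurePreserving_pi _ _ fun _ => measurePreserving_snd
  have step1 : ∫ x, (⨆ i, ∑ k, ((∫ z, l i z ∂D) - l i (x k))) ∂P ≤
      ∫ z, T (fun _ => true) z ∂P2 := by
    have harr := measurePreserving_arrowProdEquivProdArrow X X (Fin n) (fun _ => D) fun _ => D
    have h1 : ∫ z, T (fun _ => true) z ∂P2 =
        ∫ p, (⨆ i, ∑ k, (l i (p.2 k) - l i (p.1 k))) ∂(P.prod P) := by
      rw [← harr.integral_comp' fun p => ⨆ i, ∑ k, (l i (p.2 k) - l i (p.1 k))]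
      simp [hT, boolSign, MeasurableEquiv.arrowProdEquivProdArrow, Equiv.arrowProdEquivProdArrow,
        P2]
    have hm2 : ∀ i, Measurable fun p : (Fin n → X) × (Fin n → X) =>
        ∑ k, (l i (p.2 k) - l i (p.1 k)) := fun i =>
      Finset.measurable_sum _ fun k _ =>
        ((hlk i k).comp measurable_snd).sub ((hlk i k).comp measurable_fst)
    have hb2 : ∀ i (p : (Fin n → X) × (Fin n → X)), |∑ k, (l i (p.2 k) - l i (p.1 k))| ≤
        n * (2 * K) := fun i p => abs_sum_le_nsmul fun k =>
      (abs_sub _ _).trans (by linarith [hK i (p.2 k), hK i (p.1 k)])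
    have hint : Integrable (fun p : (Fin n → X) × (Fin n → X) =>
        ⨆ i, ∑ k, (l i (p.2 k) - l i (p.1 k))) (P.prod P) :=
      integrable_of_abs_le (Measurable.iSup hm2) fun p => abs_ciSup_le fun i => hb2 i p
    rw [h1, integral_prod _ hint]
    refine integral_mono (integrable_of_abs_le (C := n * (2 * K)) ?_ ?_) hint.integral_prod_left ?_
    · exact Measurable.iSup fun i => Finset.measurable_sum _ fun k _ =>
        measurable_const.sub (hlk i k)
    · exact fun x => abs_ciSup_le fun i => abs_sum_le_nsmul fun k =>
        (abs_sub _ _).trans (by linarith [hK i (x k), hmeanK i])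
    · refine fun x => ciSup_le fun i => ?_
      have h2 : ∑ k, ((∫ z, l i z ∂D) - l i (x k)) = ∫ y, ∑ k, (l i (y k) - l i (x k)) ∂P := by
        have hi : ∀ k, Integrable (fun y : Fin n → X => l i (y k)) P := fun k =>
          integrable_of_abs_le (hlk i k) fun y => hK i _
        rw [integral_finsetSum (f := fun k (y : Fin n → X) => l i (y k) - l i (x k)) _
          fun k _ => (hi k).sub (integrable_const _)]
        refine Finset.sum_congr rfl fun k _ => ?_
        rw [integral_sub (hi k) (integrable_const _), integral_const]
        congr 1
        · exact (integral_comp_measurePreserving (measurePreserving_eval (fun _ : Fin n => D) k)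
            (hl i)).symm
        · simp
      rw [h2]
      refine integral_mono (integrable_of_abs_le ((hm2 i).comp measurable_prodMk_left)
        fun y => hb2 i (x, y)) (integrable_of_abs_le (C := n * (2 * K))
          ((Measurable.iSup hm2).comp measurable_prodMk_left)
          fun y => abs_ciSup_le fun i => hb2 i (x, y)) fun y => ?_
      exact le_ciSup_finite (fun i => ∑ k, (l i (y k) - l i (x k))) i
  have step2 : ∀ σ, ∫ z, T (fun _ => true) z ∂P2 = ∫ z, T σ z ∂P2 := fun σ => by
    have hswap : MeasurePreserving (fun (z : Fin n → X × X) k => if σ k then z k else (z k).swap)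
        P2 P2 := by
      refine measurePreserving_pi (f := fun k (p : X × X) => if σ k then p else p.swap) _ _
        fun k => ?_
      cases h : σ k
      · simpa using! Measure.measurePreserving_swap (μ := D) (ν := D)
      · simpa using! MeasurePreserving.id (D.prod D)
    rw [← integral_comp_measurePreserving hswap (hTm _)]
    congr 1
    ext z
    refine iSup_congr fun i => Finset.sum_congr rfl fun k _ => ?_
    cases h : σ k <;> simp [boolSign, h]
  have step3 : ∀ σ, ∫ z, T σ z ∂P2 ≤ ∫ x, R σ x ∂P + ∫ x, R (fun k => !σ k) x ∂P := fun σ => by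
    rw [← integral_comp_measurePreserving hsnd (hRm _),
      ← integral_comp_measurePreserving hfst (hRm fun k => !σ k)]
    have hi1 := hsnd.integrable_comp_of_integrable (hRi σ)
    have hi2 := hfst.integrable_comp_of_integrable (hRi fun k => !σ k)
    refine le_trans ?_ (integral_add hi1 hi2).le
    refine integral_mono (integrable_of_abs_le (hTm σ) (hTb σ)) (hi1.add hi2) fun z => ?_
    refine ciSup_le fun i => ?_
    refine le_trans (le_of_eq ?_) (add_le_add
      (le_ciSup_finite (fun i => ∑ k, boolSign (σ k) * l i (z k).2) i)
      (le_ciSup_finite (fun i => ∑ k, boolSign (!σ k) * l i (z k).1) i))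
    simp only [← Finset.sum_add_distrib, boolSign_not]
    exact Finset.sum_congr rfl fun k _ => by ring
  have hflip : ∑ σ : Fin n → Bool, ∫ x, R (fun k => !σ k) x ∂P = ∑ σ, ∫ x, R σ x ∂P :=
    Function.Bijective.sum_comp (e := fun (σ : Fin n → Bool) k => !σ k)
      (Function.Involutive.bijective fun σ => by ext; simp) fun σ => ∫ x, R σ x ∂P
  calc _ ≤ 2 ^ n * ∫ z, T (fun _ => true) z ∂P2 :=
        mul_le_mul_of_nonneg_left step1 (by positivity)
    _ = ∑ σ : Fin n → Bool, ∫ z, T (fun _ => true) z ∂P2 := by simp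
    _ ≤ ∑ σ : Fin n → Bool, (∫ x, R σ x ∂P + ∫ x, R (fun k => !σ k) x ∂P) :=
        Finset.sum_le_sum fun σ _ => (step2 σ).le.trans (step3 σ)
    _ = 2 * ∑ σ : Fin n → Bool, ∫ x, R σ x ∂P := by rw [Finset.sum_add_distrib, hflip]; ring
    _ = _ := by
        rw [← integral_finsetSum _ fun σ _ => hRi σ]
        rfl

end Symmetrization

/-! ### Uniform convergence over a ball of linear functionals -/

section Uniform

variable {X : Type*} [MeasurableSpace X] {E : Type*} [NormedAddCommGroup E] [InnerProductSpace ℝ E]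

/-- `n` times the amount by which the expected loss of the predictor `f` exceeds its mean loss on
the sample `x`. -/
noncomputable def lossGap (L : ℝ → ℝ → ℝ) (D : Measure X) (g : X → ℝ) {n : ℕ} (x : Fin n → X)
    (f : X → ℝ) : ℝ :=
  ∑ k, ((∫ z, L (g z) (f z) ∂D) - L (g (x k)) (f (x k)))

section Loss

variable {L : ℝ → ℝ → ℝ} {Λ : ℝ}

lemma IsBoundedLipschitzLoss.abs_le (hL : IsBoundedLipschitzLoss L Λ) (y z : ℝ) : |L y z| ≤ Λ := by
  rw [abs_of_nonneg (hL.nonneg y z)]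
  exact hL.le_bound y z

lemma IsBoundedLipschitzLoss.abs_sub_le (hL : IsBoundedLipschitzLoss L Λ) (y z z' : ℝ) :
    |L y z - L y z'| ≤ |z - z'| := by
  simpa [Real.dist_eq] using (hL.lipschitz y).dist_le_mul z z'

lemma IsBoundedLipschitzLoss.le_abs_sub (hL : IsBoundedLipschitzLoss L Λ) (y z : ℝ) :
    L y z ≤ |z - y| := by
  have := hL.abs_sub_le y z y
  rw [hL.self_eq_zero, sub_zero] at this
  exact (le_abs_self _).trans this

lemma IsBoundedLipschitzLoss.measurable_comp (hL : IsBoundedLipschitzLoss L Λ) {Y : Type*}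
    [MeasurableSpace Y] {f g : Y → ℝ} (hg : Measurable g) (hf : Measurable f) :
    Measurable fun x => L (g x) (f x) :=
  hL.measurable.comp (hg.prodMk hf)

end Loss

/-- The expected supremum of the loss gap over a finite family of functionals of norm at most `B`,
to which the target `g` itself is added; its loss vanishes, so that the supremum is nonnegative. -/
lemma integral_ciSup_lossGap_le (D : Measure X) [IsProbabilityMeasure D] {L : ℝ → ℝ → ℝ} {Λ : ℝ}
    (hL : IsBoundedLipschitzLoss L Λ) {g : X → ℝ} (hg : Measurable g) {G : ℝ} (hG : ∀ x, |g x| ≤ G)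
    {ψ : X → E} (hψ : ∀ v, Measurable fun x => inner ℝ v (ψ x))
    (hψi : Integrable (fun x => ‖ψ x‖ ^ 2) D) {κ : ℝ} (hκ : 0 < κ) (hψκ : ∫ x, ‖ψ x‖ ^ 2 ∂D ≤ κ)
    {ι : Type*} [Finite ι] [Nonempty ι] {B : ℝ} {v : ι → E} (hv : ∀ i, ‖v i‖ ≤ B) {n : ℕ}
    (hn : 0 < n) :
    ∫ x, (⨆ o : Option ι, lossGap L D g x (o.elim g fun i z => inner ℝ (v i) (ψ z)))
      ∂(Measure.pi fun _ : Fin n => D) ≤ 2 * (√n * (B * √κ + G)) := by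
  set P : Measure (Fin n → X) := Measure.pi fun _ => D
  set f : Option ι → X → ℝ := fun o => o.elim g fun i z => inner ℝ (v i) (ψ z) with hf
  have hfm : ∀ o, Measurable (f o) := fun o => by
    cases o with
    | none => exact hg
    | some i => exact hψ (v i)
  have hB : 0 ≤ B := (norm_nonneg _).trans (hv (Classical.arbitrary ι))
  have hn0 : (0 : ℝ) < n := by exact_mod_cast hn
  have hG0 : 0 ≤ G := by
    obtain ⟨x⟩ := nonempty_of_isProbabilityMeasure D
    exact (abs_nonneg _).trans (hG x)
  have hsymm := integral_ciSup_deviation_le D (l := fun o x => L (g x) (f o x))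
    (fun o => hL.measurable_comp hg (hfm o)) (fun o x => hL.abs_le _ _) n
  -- the arithmetic-geometric mean inequality `√s ≤ (s / r + r) / 2` replaces Jensen's inequality
  set r := √n * √κ with hr
  have hr0 : 0 < r := by positivity
  have hr2 : r ^ 2 = n * κ := by rw [hr, mul_pow, Real.sq_sqrt hn0.le, Real.sq_sqrt hκ.le]
  have hpt : ∀ x : Fin n → X, radSum (fun o k => L (g (x k)) (f o (x k))) ≤
      2 ^ n * (B * (((∑ k, ‖ψ (x k)‖ ^ 2) / r + r) / 2) + √n * G) := fun x => by
    have h0 : radSum (fun o k => L (g (x k)) (f o (x k))) ≤ radSum (fun o k => f o (x k)) :=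
      radSum_contraction (fun o k => L (g (x k)) (f o (x k))) (fun o k => f o (x k))
        fun o o' k => hL.abs_sub_le (g (x k)) (f o (x k)) (f o' (x k))
    have h1 := radSum_option_inner_le hv (fun k => ψ (x k)) (fun k => g (x k))
    have hfo : (fun (o : Option ι) k => f o (x k)) =
        fun o k => o.elim (g (x k)) fun i => inner ℝ (v i) (ψ (x k)) := by
      ext o k
      cases o <;> rfl
    rw [hfo] at h0
    refine h0.trans (h1.trans ?_)
    · have h2 : √(∑ k, g (x k) ^ 2) ≤ √n * G := by
        rw [← Real.sqrt_sq hG0, ← Real.sqrt_mul hn0.le]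
        refine Real.sqrt_le_sqrt ((Finset.sum_le_sum (g := fun _ => G ^ 2) fun k _ => ?_).trans
          (le_of_eq (by simp)))
        exact sq_le_sq.2 (by rw [abs_of_nonneg hG0]; exact hG _)
      have h3 : √(∑ k, ‖ψ (x k)‖ ^ 2) ≤ ((∑ k, ‖ψ (x k)‖ ^ 2) / r + r) / 2 := by
        have hs : 0 ≤ ∑ k, ‖ψ (x k)‖ ^ 2 := by positivity
        rw [le_div_iff₀ two_pos, div_add' _ _ _ hr0.ne', le_div_iff₀ hr0]
        nlinarith [sq_nonneg (√(∑ k, ‖ψ (x k)‖ ^ 2) - r), Real.sq_sqrt hs]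
      gcongr
  have hev : ∀ k : Fin n, Integrable (fun x : Fin n → X => ‖ψ (x k)‖ ^ 2) P := fun k =>
    (measurePreserving_eval (fun _ : Fin n => D) k).integrable_comp_of_integrable hψi
  have hevint : ∀ k : Fin n, ∫ x : Fin n → X, ‖ψ (x k)‖ ^ 2 ∂P = ∫ x, ‖ψ x‖ ^ 2 ∂D := fun k => by
    have hmp := measurePreserving_eval (fun _ : Fin n => D) k
    rw [← hmp.map_eq, integral_map hmp.measurable.aemeasurable]
    rw [hmp.map_eq]
    exact hψi.aestronglyMeasurable
  have hsumi := integrable_finsetSum Finset.univ fun k _ => hev k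
  have hradb : ∀ x : Fin n → X, |radSum (fun o k => L (g (x k)) (f o (x k)))| ≤
      2 ^ n * (n * Λ) := fun x => by
    refine (Finset.abs_sum_le_sum_abs _ _).trans ((Finset.sum_le_sum (g := fun _ => n * Λ)
      fun σ _ => abs_ciSup_le fun o => abs_sum_le_nsmul fun k => ?_).trans ?_)
    · rw [abs_mul, abs_boolSign, one_mul]
      exact hL.abs_le _ _
    · simp
  have hradm : Measurable fun x : Fin n → X => radSum (fun o k => L (g (x k)) (f o (x k))) :=
    Finset.measurable_sum _ fun σ _ => Measurable.iSup fun o => Finset.measurable_sum _ fun k _ =>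
      ((hL.measurable_comp hg (hfm o)).comp (measurable_pi_apply k)).const_mul _
  have hint : ∫ x, radSum (fun o k => L (g (x k)) (f o (x k))) ∂P ≤
      2 ^ n * (√n * (B * √κ + G)) := by
    refine (integral_mono (integrable_of_abs_le hradm hradb) ?_ hpt).trans ?_
    · exact ((((((hsumi.div_const r).add (integrable_const r)).div_const 2)).const_mul B).add
        (integrable_const _)).const_mul _
    · rw [integral_const_mul, integral_add _ (integrable_const _), integral_const_mul,
        integral_div, integral_add (hsumi.div_const r) (integrable_const _), integral_div,
        integral_finsetSum _ fun k _ => hev k]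
      · simp only [hevint, Finset.sum_const, Finset.card_univ, Fintype.card_fin, nsmul_eq_mul,
          integral_const, probReal_univ, smul_eq_mul, one_mul]
        have h4 : ((n * ∫ x, ‖ψ x‖ ^ 2 ∂D) / r + r) / 2 ≤ r := by
          have : (n * ∫ x, ‖ψ x‖ ^ 2 ∂D) / r ≤ r := by
            rw [div_le_iff₀ hr0, ← sq, hr2]
            gcongr
          linarith
        have h5 := mul_le_mul_of_nonneg_left h4 hB
        have : √n * (B * √κ + G) = B * r + √n * G := by rw [hr]; ring
        rw [this]
        gcongr
      · exact ((((hsumi.div_const r).add (integrable_const r)).div_const 2)).const_mul B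
  have h2n : (0 : ℝ) < 2 ^ n := by positivity
  have := hsymm.trans (mul_le_mul_of_nonneg_left hint zero_le_two)
  refine le_of_mul_le_mul_left (this.trans (le_of_eq ?_)) h2n
  ring

/-- Uniform convergence for a finite family of functionals: McDiarmid's inequality gives the
exponential tail, and for confidence parameters `δ ≥ 1 / 2` Markov's inequality suffices. -/
lemma measure_exists_lossGap_finite_le (D : Measure X) [IsProbabilityMeasure D] {L : ℝ → ℝ → ℝ}
    {Λ : ℝ} (hΛ : 0 < Λ)
    (hL : IsBoundedLipschitzLoss L Λ) {g : X → ℝ} (hg : Measurable g) {G : ℝ} (hG : ∀ x, |g x| ≤ G)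
    {ψ : X → E} (hψ : ∀ v, Measurable fun x => inner ℝ v (ψ x))
    (hψi : Integrable (fun x => ‖ψ x‖ ^ 2) D) {κ : ℝ} (hκ : 0 < κ) (hψκ : ∫ x, ‖ψ x‖ ^ 2 ∂D ≤ κ)
    {ι : Type*} [Finite ι] [Nonempty ι] {B : ℝ} {v : ι → E} (hv : ∀ i, ‖v i‖ ≤ B) {n : ℕ}
    (hn : 0 < n) {t δ : ℝ} (ht : 0 < t) (hrad : 2 * (B * √κ + G) ≤ t / 4 * √n)
    (hδ : 1 / 2 ≤ δ ∨ Real.exp (-(n * t ^ 2 / (2 * Λ ^ 2))) ≤ δ / 2) :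
    (Measure.pi fun _ : Fin n => D)
        {x | ∃ i, n * t ≤ lossGap L D g x fun z => inner ℝ (v i) (ψ z)} ≤
      ENNReal.ofReal (δ / 2) := by
  set P : Measure (Fin n → X) := Measure.pi fun _ => D
  set f : Option ι → X → ℝ := fun o => o.elim g fun i z => inner ℝ (v i) (ψ z) with hf
  have hfm : ∀ o, Measurable (f o) := fun o => by
    cases o with
    | none => exact hg
    | some i => exact hψ (v i)
  have hn0 : (0 : ℝ) < n := by exact_mod_cast hn
  set T : (Fin n → X) → ℝ := fun x => ⨆ o, lossGap L D g x (f o) with hT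
  have hmean : ∫ x, T x ∂P ≤ n * t / 4 := by
    refine (integral_ciSup_lossGap_le D hL hg hG hψ hψi hκ hψκ hv hn).trans ?_
    calc 2 * (√n * (B * √κ + G)) = √n * (2 * (B * √κ + G)) := by ring
      _ ≤ √n * (t / 4 * √n) := by gcongr
      _ = (√n * √n) * t / 4 := by ring
      _ = _ := by rw [Real.mul_self_sqrt hn0.le]
  have hlm : ∀ o, Measurable fun x => L (g x) (f o x) := fun o => hL.measurable_comp hg (hfm o)
  have hmeanΛ : ∀ o, |∫ z, L (g z) (f o z) ∂D| ≤ Λ := fun o => by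
    simpa using norm_integral_le_of_norm_le_const (μ := D) (f := fun z => L (g z) (f o z)) (C := Λ)
      (ae_of_all _ fun x => hL.abs_le _ _)
  have hTm : Measurable T := Measurable.iSup fun o => Finset.measurable_sum _ fun k _ =>
    measurable_const.sub ((hlm o).comp (measurable_pi_apply k))
  have hTb : ∀ x, |T x| ≤ n * (2 * Λ) := fun x => abs_ciSup_le fun o => abs_sum_le_nsmul fun k =>
    (abs_sub _ _).trans (by linarith [hmeanΛ o, hL.abs_le (g (x k)) (f o (x k))])
  have hT0 : ∀ x, 0 ≤ T x := fun x => by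
    refine le_trans (le_of_eq ?_) (le_ciSup_finite (fun o => lossGap L D g x (f o)) none)
    simp [lossGap, hf, hL.self_eq_zero]
  have hdiff : ∀ x i y, |T (Function.update x i y) - T x| ≤ Λ := fun x i y => by
    refine abs_ciSup_sub_ciSup_le fun o => ?_
    rw [lossGap, lossGap, ← Finset.sum_sub_distrib, Finset.sum_eq_single i]
    · simp only [Function.update_self]
      have h1 := hL.nonneg (g y) (f o y)
      have h2 := hL.nonneg (g (x i)) (f o (x i))
      have h3 := hL.le_bound (g y) (f o y)
      have h4 := hL.le_bound (g (x i)) (f o (x i))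
      rw [_root_.abs_le]
      constructor <;> linarith
    · intro k _ hk
      simp [Function.update_of_ne hk]
    · simp
  have hsub : {x | ∃ i, n * t ≤ lossGap L D g x fun z => inner ℝ (v i) (ψ z)} ⊆
      {x | n * t ≤ T x} := by
    rintro x ⟨i, hi⟩
    exact le_trans hi (le_ciSup_finite (fun o => lossGap L D g x (f o)) (some i))
  refine (measure_mono hsub).trans ?_
  rw [← ofReal_measureReal]
  refine ENNReal.ofReal_le_ofReal ?_
  rcases hδ with hδ | hδ
  · have hmarkov := mul_meas_ge_le_integral_of_nonneg (μ := P) (ae_of_all _ hT0)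
      (integrable_of_abs_le hTm hTb) (n * t)
    have hnt : 0 < n * t := by positivity
    have : P.real {x | n * t ≤ T x} ≤ 1 / 4 := by
      refine le_of_mul_le_mul_left (hmarkov.trans (hmean.trans (le_of_eq (by ring)))) hnt
    linarith
  · have hmc := measure_ge_le_of_bounded_differences D (s := n * t / 2) hΛ (by positivity) hn
      hTm hTb hdiff
    refine (measureReal_mono ?_).trans (hmc.trans (le_trans (le_of_eq ?_) hδ))
    · intro x hx
      have : n * t ≤ T x := hx
      change (∫ x, T x ∂P) + n * t / 2 ≤ T x
      linarith [mul_pos hn0 ht]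
    · congr 2
      field_simp

end Uniform

section UniformSeparable

variable {X : Type*} [MeasurableSpace X] {E : Type*} [NormedAddCommGroup E] [InnerProductSpace ℝ E]

/-- Uniform convergence for a sequence of functionals. -/
lemma measure_exists_lossGap_seq_le (D : Measure X) [IsProbabilityMeasure D] {L : ℝ → ℝ → ℝ}
    {Λ : ℝ} (hΛ : 0 < Λ)
    (hL : IsBoundedLipschitzLoss L Λ) {g : X → ℝ} (hg : Measurable g) {G : ℝ} (hG : ∀ x, |g x| ≤ G)
    {ψ : X → E} (hψ : ∀ v, Measurable fun x => inner ℝ v (ψ x))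
    (hψi : Integrable (fun x => ‖ψ x‖ ^ 2) D) {κ : ℝ} (hκ : 0 < κ) (hψκ : ∫ x, ‖ψ x‖ ^ 2 ∂D ≤ κ)
    {B : ℝ} {v : ℕ → E} (hv : ∀ i, ‖v i‖ ≤ B) {n : ℕ}
    (hn : 0 < n) {t δ : ℝ} (ht : 0 < t) (hrad : 2 * (B * √κ + G) ≤ t / 4 * √n)
    (hδ : 1 / 2 ≤ δ ∨ Real.exp (-(n * t ^ 2 / (2 * Λ ^ 2))) ≤ δ / 2) :
    (Measure.pi fun _ : Fin n => D)
        {x | ∃ i, n * t ≤ lossGap L D g x fun z => inner ℝ (v i) (ψ z)} ≤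
      ENNReal.ofReal (δ / 2) := by
  set A : ℕ → Set (Fin n → X) := fun N =>
    {x | ∃ i : Fin (N + 1), n * t ≤ lossGap L D g x fun z => inner ℝ (v i) (ψ z)}
  have hA : Monotone A := by
    rintro N N' h x ⟨i, hi⟩
    exact ⟨⟨i, by omega⟩, hi⟩
  have hU : {x | ∃ i, n * t ≤ lossGap L D g x fun z => inner ℝ (v i) (ψ z)} = ⋃ N, A N := by
    ext x
    simp only [Set.mem_iUnion]
    exact ⟨fun ⟨i, hi⟩ => ⟨i, ⟨i, by omega⟩, hi⟩, fun ⟨N, i, hi⟩ => ⟨i, hi⟩⟩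
  rw [hU, hA.measure_iUnion]
  exact iSup_le fun N => measure_exists_lossGap_finite_le D hΛ hL hg hG hψ hψi hκ hψκ
    (v := fun i : Fin (N + 1) => v i) (fun i => hv i) hn ht hrad hδ

lemma continuous_lossGap (D : Measure X) [IsProbabilityMeasure D] {L : ℝ → ℝ → ℝ} {Λ : ℝ}
    (hL : IsBoundedLipschitzLoss L Λ) {g : X → ℝ} (hg : Measurable g)
    {ψ : X → E} (hψ : ∀ v, Measurable fun x => inner ℝ v (ψ x))
    (hψi : Integrable (fun x => ‖ψ x‖ ^ 2) D) {n : ℕ} (x : Fin n → X) :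
    Continuous fun v : E => lossGap L D g x fun z => inner ℝ v (ψ z) := by
  have hLc : ∀ y, Continuous (L y) := fun y => (hL.lipschitz y).continuous
  refine continuous_finsetSum _ fun k _ => Continuous.sub ?_ ((hLc _).comp (by fun_prop))
  have hli : ∀ v, Integrable (fun z => L (g z) (inner ℝ v (ψ z))) D := fun v =>
    integrable_of_abs_le (hL.measurable_comp hg (hψ v)) fun z => hL.abs_le _ _
  have hb : Integrable (fun z => 1 + ‖ψ z‖ ^ 2) D := (integrable_const _).add hψi
  refine LipschitzWith.continuous (K := (∫ z, (1 + ‖ψ z‖ ^ 2) ∂D).toNNReal)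
    (LipschitzWith.of_dist_le_mul fun v w => ?_)
  rw [Real.coe_toNNReal _ (integral_nonneg fun z => by positivity), dist_eq_norm, dist_eq_norm,
    ← integral_sub (hli v) (hli w), ← integral_mul_const]
  refine norm_integral_le_of_norm_le (hb.mul_const _) (ae_of_all _ fun z => ?_)
  refine (hL.abs_sub_le _ _ _).trans ?_
  rw [← inner_sub_left]
  refine (abs_real_inner_le_norm _ _).trans ?_
  rw [mul_comm]
  refine mul_le_mul_of_nonneg_right ?_ (norm_nonneg _)
  nlinarith [sq_nonneg (‖ψ z‖ - 1)]

/-- Uniform convergence for a separable set of functionals of norm at most `B`. -/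
lemma measure_exists_lossGap_le (D : Measure X) [IsProbabilityMeasure D] {L : ℝ → ℝ → ℝ}
    {Λ : ℝ} (hΛ : 0 < Λ)
    (hL : IsBoundedLipschitzLoss L Λ) {g : X → ℝ} (hg : Measurable g) {G : ℝ} (hG : ∀ x, |g x| ≤ G)
    {ψ : X → E} (hψ : ∀ v, Measurable fun x => inner ℝ v (ψ x))
    (hψi : Integrable (fun x => ‖ψ x‖ ^ 2) D) {κ : ℝ} (hκ : 0 < κ) (hψκ : ∫ x, ‖ψ x‖ ^ 2 ∂D ≤ κ)
    {B : ℝ} {V : Set E} (hVs : TopologicalSpace.IsSeparable V) (hV : ∀ v ∈ V, ‖v‖ ≤ B) {n : ℕ}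
    (hn : 0 < n) {t δ : ℝ} (ht : 0 < t) (hrad : 2 * (B * √κ + G) ≤ t / 4 * √n)
    (hδ : 1 / 2 ≤ δ ∨ Real.exp (-(n * t ^ 2 / (2 * Λ ^ 2))) ≤ δ / 2) :
    (Measure.pi fun _ : Fin n => D)
        {x | ∃ v ∈ V, n * t < lossGap L D g x fun z => inner ℝ v (ψ z)} ≤
      ENNReal.ofReal (δ / 2) := by
  obtain ⟨s, hsV, hsc, hVs⟩ := hVs.exists_countable_dense_subset
  rcases s.eq_empty_or_nonempty with rfl | hne
  · have : V = ∅ := by simpa using hVs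
    simp [this]
  obtain ⟨u, rfl⟩ := hsc.exists_eq_range hne
  refine (measure_mono ?_).trans (measure_exists_lossGap_seq_le D hΛ hL hg hG hψ hψi hκ hψκ (v := u)
    (fun i => hV _ (hsV ⟨i, rfl⟩)) hn ht hrad hδ)
  rintro x ⟨v, hv, hx⟩
  have hopen : IsOpen {w : E | n * t < lossGap L D g x fun z => inner ℝ w (ψ z)} :=
    isOpen_lt continuous_const (continuous_lossGap D hL hg hψ hψi x)
  obtain ⟨_, hw, i, rfl⟩ := mem_closure_iff.1 (hVs hv) _ hopen hx
  exact ⟨i, le_of_lt hw⟩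

end UniformSeparable

/-! ### The feature map of a dot product kernel -/

section FeatureMap

variable {d : ℕ}

/-- The tensor product `β 0 ⊗ β 1 ⊗ ⋯` of vectors of `ℝ^d`, given by its coordinates. -/
noncomputable def tensorProd {k : ℕ} (β : Fin k → EuclideanSpace ℝ (Fin d)) :
    EuclideanSpace ℝ (Fin k → Fin d) :=
  WithLp.toLp 2 fun I => ∏ j, β j (I j)

lemma inner_tensorProd {k : ℕ} (β γ : Fin k → EuclideanSpace ℝ (Fin d)) :
    inner ℝ (tensorProd β) (tensorProd γ) = ∏ j, inner ℝ (β j) (γ j) := by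
  simp only [tensorProd, PiLp.inner_apply, Finset.prod_univ_sum, Fintype.piFinset_univ]
  refine Finset.sum_congr rfl fun I _ => ?_
  simp [Finset.prod_mul_distrib]

lemma norm_tensorProd {k : ℕ} (β : Fin k → EuclideanSpace ℝ (Fin d)) :
    ‖tensorProd β‖ = ∏ j, ‖β j‖ := by
  have h : ‖tensorProd β‖ ^ 2 = (∏ j, ‖β j‖) ^ 2 := by
    rw [← real_inner_self_eq_norm_sq, inner_tensorProd, ← Finset.prod_pow]
    simp
  exact (sq_eq_sq₀ (norm_nonneg _) (Finset.prod_nonneg fun _ _ => norm_nonneg _)).1 h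

/-- The Hilbert space of square summable sequences of tensors of orders `0, 1, 2, …`. -/
abbrev TensorSeq (d : ℕ) : Type := lp (fun k : ℕ => EuclideanSpace ℝ (Fin k → Fin d)) 2

lemma isSeparable_univ_tensorSeq : TopologicalSpace.IsSeparable (Set.univ : Set (TensorSeq d)) := by
  have h1 : TopologicalSpace.IsSeparable (⋃ k : ℕ,
      Set.range fun u : EuclideanSpace ℝ (Fin k → Fin d) =>
        (lp.single 2 k u : TensorSeq d)) :=
    TopologicalSpace.IsSeparable.iUnion fun k =>
      TopologicalSpace.isSeparable_range (lp.isometry_single (p := 2)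
        (E := fun k : ℕ => EuclideanSpace ℝ (Fin k → Fin d)) k).continuous
  refine (h1.span (R := ℝ)).closure.mono fun v _ => ?_
  refine mem_closure_of_tendsto (lp.hasSum_single (by simp) v) (Eventually.of_forall fun s => ?_)
  exact Submodule.sum_mem _ fun k _ => Submodule.subset_span (Set.mem_iUnion.2 ⟨k, v k, rfl⟩)

variable {b : ℕ → ℝ}

lemma SlowlyDecaying.pos (hb : SlowlyDecaying b) (k : ℕ) : 0 < b k := by
  obtain ⟨-, c, hc, h⟩ := hb
  exact lt_of_lt_of_le (by positivity) (h k)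

/-- The feature map `x ↦ (√b_k x^{⊗k})_k` of the kernel `∑ b_k (x ⬝ x')^k`. -/
noncomputable def featureMap (hb : SlowlyDecaying b) (x : USphere d) : TensorSeq d :=
  ⟨fun k => √(b k) • tensorProd fun _ => (x : EuclideanSpace ℝ (Fin d)), by
    refine memℓp_gen ?_
    simpa [norm_smul, norm_tensorProd, Real.sq_sqrt (hb.pos _).le] using hb.1⟩

lemma featureMap_apply (hb : SlowlyDecaying b) (x : USphere d) (k : ℕ) :
    featureMap hb x k = √(b k) • tensorProd fun _ => (x : EuclideanSpace ℝ (Fin d)) := rfl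

lemma inner_featureMap (hb : SlowlyDecaying b) (x x' : USphere d) :
    inner ℝ (featureMap hb x) (featureMap hb x') = dotKernel b x x' := by
  rw [lp.inner_eq_tsum, dotKernel]
  refine tsum_congr fun k => ?_
  rw [featureMap_apply, featureMap_apply, real_inner_smul_left, real_inner_smul_right,
    inner_tensorProd, ← mul_assoc, Real.mul_self_sqrt (hb.pos k).le]
  simp

lemma dotKernel_self (x : USphere d) : dotKernel b x x = ∑' k, b k := by
  simp [dotKernel]

lemma norm_featureMap_sq (hb : SlowlyDecaying b) (x : USphere d) :
    ‖featureMap hb x‖ ^ 2 = ∑' k, b k := by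
  rw [← real_inner_self_eq_norm_sq, inner_featureMap, dotKernel_self]

lemma measurable_inner_featureMap (hb : SlowlyDecaying b) (v : TensorSeq d) :
    Measurable fun x => inner ℝ v (featureMap hb x) := by
  simp only [lp.inner_eq_tsum, featureMap_apply]
  refine Measurable.tsum fun k => ?_
  have : Measurable fun x : USphere d =>
      tensorProd fun _ : Fin k => (x : EuclideanSpace ℝ (Fin d)) := by
    refine (Continuous.measurable ?_)
    unfold tensorProd
    fun_prop
  fun_prop

/-- A Vandermonde type argument: polynomials separate `1` from the off-diagonal entries of `q`. -/
lemma eq_zero_of_sum_mul_pow_eq_zero {ι : Type*} [Fintype ι] {q : ι → ι → ℝ} {z : ι → ℝ}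
    (hdiag : ∀ j, q j j = 1) (hq : ∀ i j, i ≠ j → q i j ≠ 1)
    (hz : ∀ j (k : ℕ), ∑ i, z i * q i j ^ k = 0) : z = 0 := by
  classical
  have hpoly : ∀ (j : ι) (p : Polynomial ℝ), ∑ i, z i * p.eval (q i j) = 0 := by
    intro j p
    simp only [Polynomial.eval_eq_sum_range, Finset.mul_sum]
    rw [Finset.sum_comm]
    refine Finset.sum_eq_zero fun k _ => ?_
    rw [← mul_zero (p.coeff k), ← hz j k, Finset.mul_sum]
    exact Finset.sum_congr rfl fun i _ => by ring
  ext j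
  -- a polynomial that vanishes at the other entries of the column, but not at `1`
  have h := hpoly j (∏ i ∈ Finset.univ.erase j, (Polynomial.X - Polynomial.C (q i j)))
  rw [Finset.sum_eq_single j] at h
  · refine (mul_eq_zero.1 h).resolve_right ?_
    rw [Polynomial.eval_prod, ← ne_eq, Finset.prod_ne_zero_iff]
    intro i hi
    simpa [hdiag, sub_eq_zero] using (hq i j (Finset.ne_of_mem_erase hi)).symm
  · intro i _ hi
    rw [Polynomial.eval_prod, Finset.prod_eq_zero (Finset.mem_erase.2 ⟨hi, Finset.mem_univ i⟩)]
    · simp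
    · simp
  · simp

/-- The features of distinct points of the sphere are linearly independent, since all `b_k` are
positive. -/
lemma eq_zero_of_sum_smul_featureMap_eq_zero (hb : SlowlyDecaying b) {s : Finset (USphere d)}
    {z : s → ℝ} (hz : ∑ i, z i • featureMap hb (i : USphere d) = 0) : z = 0 := by
  have hnorm : ∀ i : s, ‖((i : USphere d) : EuclideanSpace ℝ (Fin d))‖ = 1 := fun i => by simp
  refine eq_zero_of_sum_mul_pow_eq_zero
    (q := fun i j : s => inner ℝ (i.1 : EuclideanSpace ℝ (Fin d)) j.1) (fun j => ?_)
    (fun i j hij => ?_) fun j k => ?_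
  · rw [real_inner_self_eq_norm_sq, hnorm, one_pow]
  · refine fun h => hij ?_
    have h := (inner_eq_one_iff_of_norm_eq_one (𝕜 := ℝ) (hnorm i) (hnorm j)).1 h
    exact Subtype.ext (Subtype.ext h)
  · have h1 := congrArg (fun v : TensorSeq d => inner ℝ (v k) (featureMap hb (j : USphere d) k)) hz
    simp only [lp.coeFn_sum, Finset.sum_apply, lp.coeFn_smul, Pi.smul_apply, sum_inner,
      real_inner_smul_left, featureMap_apply, real_inner_smul_right, inner_tensorProd,
      lp.coeFn_zero, Pi.zero_apply, inner_zero_left, Finset.prod_const, Finset.card_univ,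
      Fintype.card_fin] at h1
    refine (mul_eq_zero.1 (Eq.trans ?_ h1)).resolve_left (hb.pos k).ne'
    rw [Finset.mul_sum]
    refine Finset.sum_congr rfl fun i _ => ?_
    linear_combination (-z i * inner ℝ (i.1 : EuclideanSpace ℝ (Fin d)) j.1 ^ k) *
      Real.mul_self_sqrt (hb.pos k).le

end FeatureMap

/-! ### The target function as a vector of the feature space -/

section Target

namespace LinearFormSeries

variable {d : ℕ} {S : LinearFormSeries d}

lemma termNorm_nonneg (k : ℕ) (v : S.V k) : 0 ≤ S.termNorm k v :=
  mul_nonneg (abs_nonneg _) (Finset.prod_nonneg fun _ _ => norm_nonneg _)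

lemma tildeCoeff_nonneg (k : ℕ) : 0 ≤ S.tildeCoeff k := tsum_nonneg fun v => termNorm_nonneg k v

/-- Difference quotients of the auxiliary function dominate those of its partial sums. -/
lemma sum_mul_tildeCoeff_le (hS : S.TildeConvergesAtOne)
    (hd : DifferentiableWithinAt ℝ S.tilde (Set.Icc 0 1) 1) (s : Finset ℕ) :
    ∑ k ∈ s, k * S.tildeCoeff k ≤ S.tildeDerivOne := by
  have hsum : Summable S.tildeCoeff := by simpa using hS.2
  have h1 := hasDerivWithinAt_iff_tendsto_slope.1 hd.hasDerivWithinAt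
  have h2 : HasDerivAt (fun y : ℝ => ∑ k ∈ s, S.tildeCoeff k * y ^ k)
      (∑ k ∈ s, S.tildeCoeff k * (k * 1 ^ (k - 1))) 1 :=
    HasDerivAt.fun_sum fun k _ => (hasDerivAt_pow k 1).const_mul _
  have h3 := hasDerivWithinAt_iff_tendsto_slope.1 (h2.hasDerivWithinAt (s := Set.Icc 0 1))
  rw [Set.Icc_sdiff_right] at h1 h3
  have : (𝓝[Set.Ico (0 : ℝ) 1] 1).NeBot := right_nhdsWithin_Ico_neBot zero_lt_one
  have h4 : ∑ k ∈ s, k * S.tildeCoeff k = ∑ k ∈ s, S.tildeCoeff k * (k * 1 ^ (k - 1)) :=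
    Finset.sum_congr rfl fun k _ => by rw [one_pow]; ring
  rw [h4]
  refine le_of_tendsto_of_tendsto h3 h1 ?_
  filter_upwards [self_mem_nhdsWithin] with y hy
  rw [slope_comm, slope_comm S.tilde, slope_def_field, slope_def_field]
  refine div_le_div_of_nonneg_right ?_ (by linarith [hy.2])
  have hy1 : ∀ k : ℕ, y ^ k ≤ 1 := fun k => pow_le_one₀ hy.1 hy.2.le
  have hsy : Summable fun k => S.tildeCoeff k * y ^ k :=
    Summable.of_nonneg_of_le (fun k => mul_nonneg (tildeCoeff_nonneg k) (pow_nonneg hy.1 k))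
      (fun k => mul_le_of_le_one_right (tildeCoeff_nonneg k) (hy1 k)) hsum
  simp only [tilde, one_pow, mul_one]
  rw [← Finset.sum_sub_distrib, ← hsum.tsum_sub hsy]
  exact (hsum.sub hsy).sum_le_tsum s fun k _ =>
    sub_nonneg.2 (mul_le_of_le_one_right (tildeCoeff_nonneg k) (hy1 k))

lemma tilde_zero : S.tilde 0 = S.tildeCoeff 0 := by
  rw [tilde, tsum_eq_single 0 fun k hk => by simp [hk]]
  simp

lemma sum_max_mul_tildeCoeff_le (hS : S.TildeConvergesAtOne)
    (hd : DifferentiableWithinAt ℝ S.tilde (Set.Icc 0 1) 1) (s : Finset ℕ) :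
    ∑ k ∈ s, max (k : ℝ) 1 * S.tildeCoeff k ≤ S.tildeDerivOne + S.tilde 0 := by
  classical
  have h1 : ∀ k : ℕ, max (k : ℝ) 1 * S.tildeCoeff k =
      k * S.tildeCoeff k + if k = 0 then S.tildeCoeff 0 else 0 := fun k => by
    rcases Nat.eq_zero_or_pos k with rfl | hk
    · simp
    · rw [max_eq_left (by exact_mod_cast hk), if_neg hk.ne', add_zero]
  simp only [h1, Finset.sum_add_distrib]
  refine add_le_add (sum_mul_tildeCoeff_le hS hd s) ?_
  rw [tilde_zero, Finset.sum_ite_eq']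
  split_ifs
  · exact le_rfl
  · exact tildeCoeff_nonneg 0

lemma summable_max_mul_tildeCoeff (hS : S.TildeConvergesAtOne)
    (hd : DifferentiableWithinAt ℝ S.tilde (Set.Icc 0 1) 1) :
    Summable fun k : ℕ => max (k : ℝ) 1 * S.tildeCoeff k :=
  summable_of_sum_le (fun k => mul_nonneg (by positivity) (tildeCoeff_nonneg k))
    (sum_max_mul_tildeCoeff_le hS hd)

lemma tsum_max_mul_tildeCoeff_le (hS : S.TildeConvergesAtOne)
    (hd : DifferentiableWithinAt ℝ S.tilde (Set.Icc 0 1) 1) :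
    ∑' k : ℕ, max (k : ℝ) 1 * S.tildeCoeff k ≤ S.tildeDerivOne + S.tilde 0 :=
  Real.tsum_le_of_sum_le (fun k => mul_nonneg (by positivity) (tildeCoeff_nonneg k))
    (sum_max_mul_tildeCoeff_le hS hd)

lemma abs_onSphere_le (hS : S.TildeConvergesAtOne)
    (hd : DifferentiableWithinAt ℝ S.tilde (Set.Icc 0 1) 1) (x : USphere d) :
    |S.onSphere x| ≤ S.tildeDerivOne + S.tilde 0 := by
  refine le_trans ?_ (tsum_max_mul_tildeCoeff_le hS hd)
  rw [← Real.norm_eq_abs, onSphere]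
  refine tsum_of_norm_bounded (summable_max_mul_tildeCoeff hS hd).hasSum fun k => ?_
  refine le_trans ?_ (le_mul_of_one_le_left (tildeCoeff_nonneg k) (le_max_right _ _))
  refine tsum_of_norm_bounded (hS.1 k).hasSum fun v => ?_
  rw [norm_mul, termNorm, Real.norm_eq_abs, norm_prod]
  gcongr with i
  simpa using norm_inner_le_norm (𝕜 := ℝ) (S.β k v i) (x : EuclideanSpace ℝ (Fin d))

/-- The target function is a linear functional of the features, of norm at most
`(g̃'(1) + g̃(0)) / √c`. Its component of order `k` is `b_k^{-1/2} ∑ v, a_v β_{v,1} ⊗ ⋯ ⊗ β_{v,k}`,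
of norm at most `b_k^{-1/2} ã_k ≤ max k 1 * ã_k / √c`. -/
lemma exists_inner_featureMap_eq {b : ℕ → ℝ} (hb : SlowlyDecaying b) {c : ℝ} (hc : 0 < c)
    (hcb : ∀ k : ℕ, c / (max (k : ℝ) 1) ^ 2 ≤ b k) (hS : S.TildeConvergesAtOne)
    (hd : DifferentiableWithinAt ℝ S.tilde (Set.Icc 0 1) 1) :
    ∃ f : TensorSeq d, (∀ x, inner ℝ f (featureMap hb x) = S.onSphere x) ∧
      ‖f‖ ≤ (S.tildeDerivOne + S.tilde 0) / √c := by
  set u : ∀ k, EuclideanSpace ℝ (Fin k → Fin d) := fun k =>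
    ∑' v : S.V k, S.a k v • tensorProd (S.β k v) with hu
  have hnorm : ∀ k (v : S.V k), ‖S.a k v • tensorProd (S.β k v)‖ = S.termNorm k v := fun k v => by
    rw [norm_smul, norm_tensorProd, termNorm, Real.norm_eq_abs]
  have husum : ∀ k, Summable fun v : S.V k => S.a k v • tensorProd (S.β k v) := fun k =>
    Summable.of_norm (by simpa only [hnorm] using hS.1 k)
  have hunorm : ∀ k, ‖u k‖ ≤ S.tildeCoeff k := fun k =>
    tsum_of_norm_bounded (hS.1 k).hasSum fun v => (hnorm k v).le
  set w : ℕ → TensorSeq d := fun k => lp.single 2 k ((√(b k))⁻¹ • u k) with hw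
  have hsc : 0 < √c := Real.sqrt_pos.2 hc
  have hwnorm : ∀ k, ‖w k‖ ≤ max (k : ℝ) 1 * S.tildeCoeff k * (√c)⁻¹ := fun k => by
    rw [hw, lp.norm_single (by simp), norm_smul, norm_inv, Real.norm_of_nonneg (Real.sqrt_nonneg _)]
    have hm : (0 : ℝ) < max (k : ℝ) 1 := by positivity
    have h1 : √c / max (k : ℝ) 1 ≤ √(b k) := by
      refine Real.le_sqrt_of_sq_le ?_
      rw [div_pow, Real.sq_sqrt hc.le]
      exact hcb k
    have h2 : (√(b k))⁻¹ ≤ max (k : ℝ) 1 * (√c)⁻¹ := by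
      have := inv_anti₀ (by positivity) h1
      rwa [inv_div, div_eq_mul_inv] at this
    calc _ ≤ max (k : ℝ) 1 * (√c)⁻¹ * S.tildeCoeff k := by gcongr; exact hunorm k
      _ = _ := by ring
  have hsumm := (summable_max_mul_tildeCoeff hS hd).mul_right (√c)⁻¹
  have hwsum : Summable w := Summable.of_norm_bounded hsumm hwnorm
  refine ⟨∑' k, w k, fun x => ?_, ?_⟩
  · rw [real_inner_comm, ← innerSL_apply_apply ℝ, ContinuousLinearMap.map_tsum _ hwsum, onSphere]
    refine tsum_congr fun k => ?_
    have hbk : √(b k) ≠ 0 := (Real.sqrt_pos.2 (hb.pos k)).ne'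
    rw [innerSL_apply_apply, lp.inner_single_right, featureMap_apply, real_inner_smul_left,
      real_inner_smul_right, mul_inv_cancel_left₀ hbk, ← innerSL_apply_apply ℝ,
      ContinuousLinearMap.map_tsum _ (husum k)]
    refine tsum_congr fun v => ?_
    rw [innerSL_apply_apply, real_inner_smul_right, inner_tensorProd]
    simp only [real_inner_comm]
  · refine (tsum_of_norm_bounded hsumm.hasSum hwnorm).trans ?_
    rw [tsum_mul_right, div_eq_mul_inv]
    exact mul_le_mul_of_nonneg_right (tsum_max_mul_tildeCoeff_le hS hd) (by positivity)

end LinearFormSeries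

end Target

/-! ### Kernel interpolation -/

section KernelInterpolation

lemma mul_symmPinv_mul {n : ℕ} {H : Matrix (Fin n) (Fin n) ℝ} (hH : IsSelfAdjoint H) :
    H * symmPinv H * H = H := by
  have hfin : (spectrum ℝ H).Finite := Matrix.finite_real_spectrum
  have hc : ∀ f : ℝ → ℝ, ContinuousOn f (spectrum ℝ H) := fun f => hfin.continuousOn f
  have hid : cfc (fun t : ℝ => t) H = H := cfc_id' ℝ H
  have h : cfc (fun t : ℝ => t * t⁻¹ * t) H = H * symmPinv H * H := by
    rw [cfc_mul _ _ H (hc _) (hc _), cfc_mul _ _ H (hc _) (hc _), hid]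
    rfl
  rw [← h]
  simp only [mul_inv_mul_cancel, hid]

section Gram

variable {ι : Type*} [Fintype ι] {E : Type*} [NormedAddCommGroup E] [InnerProductSpace ℝ E]

/-- Any linear functional can be interpolated on finitely many vectors by a combination of these
vectors: the orthogonal projection onto their span. -/
lemma exists_gram_mulVec_eq (u : ι → E) (f : E) :
    ∃ z : ι → ℝ, Matrix.gram ℝ u *ᵥ z = fun i => inner ℝ f (u i) := by
  set U := Submodule.span ℝ (Set.range u)
  have : FiniteDimensional ℝ U := FiniteDimensional.span_of_finite ℝ (Set.finite_range u)
  obtain ⟨z, hz⟩ := (Submodule.mem_span_range_iff_exists_fun ℝ).1 (U.starProjection_apply_mem f)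
  refine ⟨z, funext fun i => ?_⟩
  have hi : u i ∈ U := Submodule.subset_span ⟨i, rfl⟩
  have h1 := U.starProjection_inner_eq_zero f (u i) hi
  rw [inner_sub_left, sub_eq_zero, ← hz, sum_inner] at h1
  rw [h1, Matrix.mulVec, dotProduct]
  refine Finset.sum_congr rfl fun j _ => ?_
  rw [Matrix.gram_apply, real_inner_smul_left, real_inner_comm, mul_comm]

lemma inner_sum_smul_of_gram_mulVec {u : ι → E} {α y : ι → ℝ} (h : Matrix.gram ℝ u *ᵥ α = y)
    (j : ι) : inner ℝ (∑ i, α i • u i) (u j) = y j := by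
  rw [← h, Matrix.mulVec, dotProduct, sum_inner]
  refine Finset.sum_congr rfl fun i _ => ?_
  rw [Matrix.gram_apply, real_inner_smul_left, real_inner_comm, mul_comm]

lemma norm_sq_sum_smul_of_gram_mulVec {u : ι → E} {α y : ι → ℝ} (h : Matrix.gram ℝ u *ᵥ α = y) :
    ‖∑ i, α i • u i‖ ^ 2 = α ⬝ᵥ y := by
  rw [← real_inner_self_eq_norm_sq]
  conv_lhs => rw [inner_sum]
  simp only [real_inner_smul_right, inner_sum_smul_of_gram_mulVec h, dotProduct]

/-- The interpolating combination has the least norm of all interpolating functionals. -/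
lemma norm_sum_smul_le_of_gram_mulVec {u : ι → E} {α : ι → ℝ} {f : E}
    (h : Matrix.gram ℝ u *ᵥ α = fun i => inner ℝ f (u i)) : ‖∑ i, α i • u i‖ ≤ ‖f‖ := by
  have h1 : ‖∑ i, α i • u i‖ ^ 2 = inner ℝ f (∑ i, α i • u i) := by
    rw [norm_sq_sum_smul_of_gram_mulVec h, inner_sum]
    simp only [real_inner_smul_right, dotProduct]
  have h2 := real_inner_le_norm f (∑ i, α i • u i)
  rcases eq_or_lt_of_le (norm_nonneg (∑ i, α i • u i)) with h | h
  · rw [← h]; exact norm_nonneg f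
  · nlinarith

end Gram

variable {X : Type*} {E : Type*} [NormedAddCommGroup E] [InnerProductSpace ℝ E]

/-- The model of kernel learning is a functional of the features that interpolates the sample, and
its norm is at most that of any other interpolating functional. -/
lemma exists_inner_eq_kernelLearner_train {K : X → X → ℝ} {ψ : X → E}
    (hψ : ∀ x x', inner ℝ (ψ x) (ψ x') = K x x') {g : X → ℝ} {f : E}
    (hf : ∀ x, inner ℝ f (ψ x) = g x) {n : ℕ} (x : Fin n → X) (s : (kernelLearner K).Seed n) :
    ∃ v : E, ‖v‖ ≤ ‖f‖ ∧ (∀ i, inner ℝ v (ψ (x i)) = g (x i)) ∧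
      (kernelLearner K).train n (fun i => (x i, g (x i))) s = fun z => inner ℝ v (ψ z) := by
  have hH : (Matrix.of fun i j => K (x i) (x j)) = Matrix.gram ℝ fun i => ψ (x i) := by
    ext i j
    simp [hψ]
  obtain ⟨z, hz⟩ := exists_gram_mulVec_eq (fun i => ψ (x i)) f
  simp only [hf] at hz
  set α := symmPinv (Matrix.gram ℝ fun i => ψ (x i)) *ᵥ fun i => g (x i) with hα
  have hint : (Matrix.gram ℝ fun i => ψ (x i)) *ᵥ α = fun i => g (x i) := by
    rw [hα, ← hz, Matrix.mulVec_mulVec, Matrix.mulVec_mulVec,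
      mul_symmPinv_mul (Matrix.isHermitian_gram ℝ _)]
  refine ⟨∑ i, α i • ψ (x i), norm_sum_smul_le_of_gram_mulVec (by simpa only [hf] using hint),
    inner_sum_smul_of_gram_mulVec hint, ?_⟩
  ext w
  simp only [sum_inner, real_inner_smul_left, hψ, hα, ← hH]
  rfl

end KernelInterpolation

/-! ### From failure probabilities to efficient learnability -/

section Efficient

variable {X : Type*} [MeasurableSpace X]

lemma lossGap_eq (L : ℝ → ℝ → ℝ) (D : Measure X) (g : X → ℝ) {n : ℕ} (x : Fin n → X) (f : X → ℝ) :
    lossGap L D g x f = n * (∫ z, L (g z) (f z) ∂D) - ∑ k, L (g (x k)) (f (x k)) := by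
  simp [lossGap, Finset.sum_sub_distrib]

lemma genError_eq_ofReal (D : Measure X) [IsProbabilityMeasure D] {L : ℝ → ℝ → ℝ} {Λ : ℝ}
    (hL : IsBoundedLipschitzLoss L Λ) {g f : X → ℝ} (hg : Measurable g) (hf : Measurable f) :
    genError L D g f = ENNReal.ofReal (∫ z, L (g z) (f z) ∂D) :=
  (ofReal_integral_eq_lintegral_ofReal (integrable_of_abs_le (hL.measurable_comp hg hf)
    fun _ => hL.abs_le _ _) (ae_of_all _ fun _ => hL.nonneg _ _)).symm

/-- A small loss gap and a small training loss give a small generalization error. -/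
lemma genError_lt_of_lossGap_le (D : Measure X) [IsProbabilityMeasure D] {L : ℝ → ℝ → ℝ} {Λ : ℝ}
    (hL : IsBoundedLipschitzLoss L Λ) {g f : X → ℝ} (hg : Measurable g) (hf : Measurable f) {n : ℕ}
    (hn : 0 < n) {x : Fin n → X} {s t ε : ℝ} (hε : 0 < ε) (hst : s + t < ε)
    (hgap : lossGap L D g x f ≤ n * t) (htrain : ∑ k, L (g (x k)) (f (x k)) ≤ n * s) :
    genError L D g f < ENNReal.ofReal ε := by
  rw [genError_eq_ofReal D hL hg hf, ENNReal.ofReal_lt_ofReal_iff hε]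
  rw [lossGap_eq] at hgap
  have hn0 : (0 : ℝ) < n := by exact_mod_cast hn
  have : (n : ℝ) * (∫ z, L (g z) (f z) ∂D) ≤ n * (s + t) := by linarith
  exact (le_of_mul_le_mul_left this hn0).trans_lt hst

/-- The zero model has small error if the target is uniformly small. -/
lemma failureProb_zero_examples (A : Learner X) {L : ℝ → ℝ → ℝ} {Λ : ℝ}
    (hL : IsBoundedLipschitzLoss L Λ) {g : X → ℝ} (hg : Measurable g) {Q : ℝ}
    (hgQ : ∀ x, |g x| ≤ Q) {ε : ℝ} (hε : 0 < ε) (hQ : Q < ε)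
    (hA : ∀ data s, A.train 0 data s = 0) (D : Measure X) [IsProbabilityMeasure D] :
    failureProb A L g D ε 0 = 0 := by
  have hlt : genError L D g 0 < ENNReal.ofReal ε := by
    rw [genError_eq_ofReal D hL hg measurable_zero, ENNReal.ofReal_lt_ofReal_iff hε]
    refine lt_of_le_of_lt ?_ hQ
    calc ∫ z, L (g z) ((0 : X → ℝ) z) ∂D ≤ ∫ _, Q ∂D := by
          refine integral_mono (integrable_of_abs_le (hL.measurable_comp hg measurable_zero)
            fun _ => hL.abs_le _ _) (integrable_const _) fun z => ?_
          refine (hL.le_abs_sub _ _).trans ?_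
          simpa using hgQ z
      _ = Q := by simp
  simp [failureProb, hA, hlt]

/-- A number of examples that makes both terms of the uniform convergence bound small, for radius
`A * Q`. For `δ < 1 / 2`, the factor `2` in the second term is absorbed by `δ ^ 2 ≤ δ / 2`. -/
lemma sampleSize_bounds {A Λ Q ε δ : ℝ} {n : ℕ} (hΛ : 0 < Λ) (hε : 0 < ε)
    (hδ : 0 < δ) (hδ1 : δ < 1)
    (hn : (256 * A ^ 2 + 16 * Λ ^ 2) * (Q ^ 2 + Real.log δ⁻¹) ≤ n * ε ^ 2) :
    2 * (A * Q) ≤ ε / 2 / 4 * √n ∧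
      (1 / 2 ≤ δ ∨ Real.exp (-(n * (ε / 2) ^ 2 / (2 * Λ ^ 2))) ≤ δ / 2) := by
  have hlog : 0 ≤ Real.log δ⁻¹ := Real.log_nonneg ((one_le_inv₀ hδ).2 hδ1.le)
  have h1 : 256 * A ^ 2 * Q ^ 2 ≤ n * ε ^ 2 := by
    have : 0 ≤ 256 * A ^ 2 * Real.log δ⁻¹ + 16 * Λ ^ 2 * Q ^ 2 + 16 * Λ ^ 2 * Real.log δ⁻¹ := by
      positivity
    nlinarith
  have h2 : 16 * Λ ^ 2 * Real.log δ⁻¹ ≤ n * ε ^ 2 := by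
    have : 0 ≤ 256 * A ^ 2 * Real.log δ⁻¹ + 16 * Λ ^ 2 * Q ^ 2 + 256 * A ^ 2 * Q ^ 2 := by
      positivity
    nlinarith
  refine ⟨?_, ?_⟩
  · have h3 : 16 * (A * Q) ≤ ε * √n := by
      refine le_of_sq_le_sq ?_ (by positivity)
      rw [mul_pow ε, Real.sq_sqrt (Nat.cast_nonneg n)]
      nlinarith
    linarith
  · rcases le_or_gt (1 / 2) δ with h | h
    · exact Or.inl h
    · refine Or.inr ?_
      have h4 : 2 * Real.log δ⁻¹ ≤ n * (ε / 2) ^ 2 / (2 * Λ ^ 2) := by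
        rw [le_div_iff₀ (by positivity)]
        nlinarith
      calc Real.exp (-(n * (ε / 2) ^ 2 / (2 * Λ ^ 2))) ≤ Real.exp (2 * Real.log δ) := by
            rw [Real.exp_le_exp]
            rw [Real.log_inv] at h4
            linarith
        _ = δ ^ 2 := by
            rw [two_mul, Real.exp_add, Real.exp_log hδ, sq]
        _ ≤ δ / 2 := by nlinarith

/-- Reduction of efficient learnability to two cases. If the accuracy `ε` exceeds `Q`, the zero
model, learned from no examples, is good enough. Otherwise the bound on the sample complexity is at
least `1`, so that rounding it down loses at most a factor `2`. -/
lemma efficientlyLearned_of_failureProb_lt {ι : Type*} {l : Filter ι} {A : ι → Learner X}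
    {L : ℝ → ℝ → ℝ} {g : X → ℝ} {C Q : ℝ} (hC : 1 ≤ C)
    (h0 : ∀ ε δ : ℝ, 0 < ε → Q < ε → 0 < δ → ∀ D : Measure X, IsProbabilityMeasure D →
      ∀ᶠ i in l, failureProb (A i) L g D ε 0 < ENNReal.ofReal δ)
    (h1 : ∀ ε δ : ℝ, 0 < ε → ε ≤ Q → 0 < δ → δ < 1 → ∀ D : Measure X, IsProbabilityMeasure D →
      ∀ n : ℕ, 0 < n → C * (Q ^ 2 + Real.log δ⁻¹) ≤ n * ε ^ 2 →
      ∀ᶠ i in l, failureProb (A i) L g D ε n < ENNReal.ofReal δ) :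
    EfficientlyLearned l A L (2 * C) g (Q ^ 2) := by
  intro ε δ hε hδ hδ1 D hD
  have key : ∀ n : ℕ, (∀ᶠ i in l, failureProb (A i) L g D ε n < ENNReal.ofReal δ) →
      (n : ℝ) ≤ 2 * C * (Q ^ 2 + Real.log δ⁻¹) / ε ^ 2 →
      (sampleComplexity l A L g D ε δ : ℝ≥0∞) ≤
        ENNReal.ofReal (2 * C * (Q ^ 2 + Real.log δ⁻¹) / ε ^ 2) := by
    intro n hn hle
    have h2 : sampleComplexity l A L g D ε δ ≤ n := sInf_le ⟨n, rfl, hn⟩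
    have h3 : (sampleComplexity l A L g D ε δ : ℝ≥0∞) ≤ ((n : ℕ∞) : ℝ≥0∞) :=
      ENat.toENNReal_le.2 h2
    refine h3.trans ?_
    rw [ENat.toENNReal_coe, ← ENNReal.ofReal_natCast]
    exact ENNReal.ofReal_le_ofReal hle
  have hlog : 0 ≤ Real.log δ⁻¹ := Real.log_nonneg ((one_le_inv₀ hδ).2 hδ1.le)
  have hC0 : 0 < C := by linarith
  rcases lt_or_ge Q ε with hQ | hQ
  · refine key 0 (h0 ε δ hε hQ hδ D hD) ?_
    rw [Nat.cast_zero]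
    positivity
  · set b := C * (Q ^ 2 + Real.log δ⁻¹) / ε ^ 2 with hb
    have hb1 : 1 ≤ b := by
      rw [hb, le_div_iff₀ (by positivity)]
      nlinarith
    refine key ⌈b⌉₊ (h1 ε δ hε hQ hδ hδ1 D hD _ (Nat.ceil_pos.2 (by linarith)) ?_) ?_
    · rw [← div_le_iff₀ (by positivity)]
      exact Nat.le_ceil b
    · have := (Nat.ceil_lt_add_one (by linarith : 0 ≤ b)).le
      have h2 : 2 * C * (Q ^ 2 + Real.log δ⁻¹) / ε ^ 2 = 2 * b := by rw [hb]; ring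
      rw [h2]
      linarith

end Efficient

/-! ### Kernel learning -/

section KernelLearning

variable {b : ℕ → ℝ} {d : ℕ}

lemma kernelLearner_train_zero (data : Fin 0 → USphere d × ℝ)
    (s : (kernelLearner (dotKernel b)).Seed 0) :
    (kernelLearner (X := USphere d) (dotKernel b)).train 0 data s = 0 := by
  ext x
  simp [kernelLearner]

lemma kernelLearner_failureProb_lt (hb : SlowlyDecaying b) {L : ℝ → ℝ → ℝ} {Λ : ℝ} (hΛ : 0 < Λ)
    (hL : IsBoundedLipschitzLoss L Λ) {g : USphere d → ℝ} {f : TensorSeq d}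
    (hf : ∀ x, inner ℝ f (featureMap hb x) = g x) {G B : ℝ} (hG : ∀ x, |g x| ≤ G) (hB : ‖f‖ ≤ B)
    (D : Measure (USphere d)) [IsProbabilityMeasure D] {n : ℕ} (hn : 0 < n) {ε δ : ℝ} (hε : 0 < ε)
    (hδ0 : 0 < δ) (hrad : 2 * (B * √(∑' k, b k) + G) ≤ ε / 2 / 4 * √n)
    (hδ : 1 / 2 ≤ δ ∨ Real.exp (-(n * (ε / 2) ^ 2 / (2 * Λ ^ 2))) ≤ δ / 2) :
    failureProb (kernelLearner (dotKernel b)) L g D ε n < ENNReal.ofReal δ := by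
  have hg : Measurable g := by
    rw [← funext hf]
    exact measurable_inner_featureMap hb f
  have hκ : 0 < ∑' k, b k := hb.1.tsum_pos (fun k => (hb.pos k).le) 0 (hb.pos 0)
  have hsep : TopologicalSpace.IsSeparable (Metric.closedBall (0 : TensorSeq d) B) :=
    isSeparable_univ_tensorSeq.mono (Set.subset_univ _)
  have hunif := measure_exists_lossGap_le D hΛ hL hg hG (measurable_inner_featureMap hb)
    (by simp only [norm_featureMap_sq]; exact integrable_const _) hκ
    (by simp [norm_featureMap_sq]) hsep (fun v hv => by simpa using hv) hn (half_pos hε) hrad hδ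
  set bad := {x : Fin n → USphere d | ∃ v ∈ Metric.closedBall (0 : TensorSeq d) B,
    n * (ε / 2) < lossGap L D g x fun z => inner ℝ v (featureMap hb z)}
  refine lt_of_le_of_lt ?_
    (hunif.trans_lt ((ENNReal.ofReal_lt_ofReal_iff hδ0).2 (half_lt_self hδ0)))
  rw [failureProb]
  calc _ ≤ ((Measure.pi fun _ : Fin n => D).prod ((kernelLearner (dotKernel b)).law n))
        (bad ×ˢ Set.univ) := by
        refine measure_mono fun p hp => ⟨?_, Set.mem_univ _⟩
        by_contra hgood
        obtain ⟨v, hvf, hvx, htrain⟩ :=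
          exists_inner_eq_kernelLearner_train (inner_featureMap hb) hf p.1 p.2
        refine hp ?_
        rw [htrain]
        refine genError_lt_of_lossGap_le (s := 0) (t := ε / 2) (x := p.1) D hL hg
          (measurable_inner_featureMap hb v) hn hε (by linarith) ?_ ?_
        · by_contra! hlt
          exact hgood ⟨v, by simpa using hvf.trans hB, hlt⟩
        · simp [hvx, hL.self_eq_zero]
    _ = _ := by
        rw [Measure.prod_prod, measure_univ, mul_one]

end KernelLearning

/-! ### Convergence in probability on product spaces -/

section LawOfLargeNumbers

open ProbabilityTheory

/-- The weak law of large numbers for integrable functions on finite product spaces. -/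
lemma tendsto_measure_pi_mean_sub_integral {W : Type*} [MeasurableSpace W] (μ : Measure W)
    [IsProbabilityMeasure μ] {f : W → ℝ} (hf : Measurable f) (hfi : Integrable f μ) {τ : ℝ}
    (hτ : 0 < τ) :
    Tendsto (fun m : ℕ => (Measure.pi fun _ : Fin m => μ)
      {w | τ ≤ |(∑ j, f (w j)) / m - ∫ w, f w ∂μ|}) atTop (𝓝 0) := by
  set P : Measure (ℕ → W) := Measure.infinitePi fun _ => μ
  have hmp : ∀ i, MeasurePreserving (fun ω : ℕ → W => ω i) P μ :=
    fun i => measurePreserving_eval_infinitePi (fun _ => μ) i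
  have hind : iIndepFun (fun i (ω : ℕ → W) => f (ω i)) P :=
    iIndepFun_infinitePi (P := fun _ => μ) (X := fun _ => f) fun _ => hf
  have hlaw : ∀ i, P.map (fun ω => f (ω i)) = μ.map f := fun i => by
    rw [← (hmp i).map_eq, Measure.map_map hf (hmp i).measurable]
    rfl
  have hslln := strong_law_ae_real (μ := P) (fun i ω => f (ω i))
    ((hmp 0).integrable_comp_of_integrable hfi) (fun i j hij => hind.indepFun hij) fun i =>
      ⟨(hf.comp (hmp i).measurable).aemeasurable, (hf.comp (hmp 0).measurable).aemeasurable,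
        by rw [hlaw, hlaw]⟩
  have hmean : ∫ ω, f (ω 0) ∂P = ∫ w, f w ∂μ := integral_comp_measurePreserving (hmp 0) hf
  have hprob := tendstoInMeasure_iff_dist.1 (tendstoInMeasure_of_tendsto_ae (fun n => by
    refine Measurable.aestronglyMeasurable ?_
    exact (Finset.measurable_sum _ fun i _ => hf.comp (hmp i).measurable).div_const _) hslln) τ hτ
  refine hprob.congr fun m => ?_
  have hrestr : MeasurePreserving (fun (ω : ℕ → W) (j : Fin m) => ω j) P
      (Measure.pi fun _ : Fin m => μ) := by
    refine ⟨measurable_pi_lambda _ fun j => measurable_pi_apply _, ?_⟩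
    have h1 : iIndepFun (fun i (ω : ℕ → W) => ω i) P :=
      iIndepFun_infinitePi (P := fun _ => μ) (X := fun _ => id) fun _ => measurable_id
    have h2 := (h1.precomp (g := fun j : Fin m => (j : ℕ)) Fin.val_injective).map_fun_eq_pi_map
      fun j : Fin m => (hmp j).measurable.aemeasurable
    refine h2.trans ?_
    congr 1
    exact funext fun j => (hmp j).map_eq
  rw [← hrestr.measure_preimage]
  · congr 1
    ext ω
    simp only [Set.mem_preimage, Set.mem_ofPred_eq, Real.dist_eq, hmean]
    rw [Finset.sum_range fun i => f (ω i)]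
  · refine (measurableSet_le measurable_const ?_).nullMeasurableSet
    have : Measurable fun w : Fin m → W => (∑ j, f (w j)) / m :=
      (Finset.measurable_sum _ fun j _ => hf.comp (measurable_pi_apply j)).div_const _
    exact (this.sub_const _).abs

/-- Dominated convergence for the measures of subsets of product spaces, given convergence of the
measures of their sections. -/
lemma tendsto_measure_prod_zero {ι : Type*} {l : Filter ι} [l.IsCountablyGenerated] {α : Type*}
    [MeasurableSpace α] {β : ι → Type*} [∀ i, MeasurableSpace (β i)] (P : Measure α)
    [IsProbabilityMeasure P] (ν : ∀ i, Measure (β i)) [∀ i, IsProbabilityMeasure (ν i)]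
    {S : ∀ i, Set (α × β i)} (hS : ∀ i, MeasurableSet (S i))
    (h : ∀ a, Tendsto (fun i => ν i (Prod.mk a ⁻¹' S i)) l (𝓝 0)) :
    Tendsto (fun i => (P.prod (ν i)) (S i)) l (𝓝 0) := by
  simp only [Measure.prod_apply (hS _)]
  have h0 : (0 : ℝ≥0∞) = ∫⁻ _ : α, 0 ∂P := by simp
  rw [h0]
  refine tendsto_lintegral_filter_of_dominated_convergence (fun _ => 1)
    (Eventually.of_forall fun i => measurable_measure_prodMk_left (hS i))
    (Eventually.of_forall fun i => ae_of_all _ fun a => prob_le_one) (by simp) (ae_of_all _ h)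

/-- A measurable real function is unlikely to exceed `1 / η` for small `η`. -/
lemma tendsto_measure_one_lt_mul {α : Type*} [MeasurableSpace α] (P : Measure α)
    [IsProbabilityMeasure P] {f : α → ℝ} (hf : Measurable f) :
    Tendsto (fun η : ℝ => P {a | 1 < η * f a}) (𝓝[>] 0) (𝓝 0) := by
  have hS : ∀ η : ℝ, MeasurableSet {a | 1 < η * f a} := fun η =>
    measurableSet_lt measurable_const (hf.const_mul _)
  simp only [← lintegral_indicator_one (hS _)]
  have h0 : (0 : ℝ≥0∞) = ∫⁻ _ : α, 0 ∂P := by simp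
  rw [h0]
  refine tendsto_lintegral_filter_of_dominated_convergence (fun _ => 1)
    (Eventually.of_forall fun η => measurable_one.indicator (hS η))
    (Eventually.of_forall fun η => ae_of_all _ fun a => Set.indicator_le_self' (by simp) a)
    (by simp) (ae_of_all _ fun a => ?_)
  have h1 : Tendsto (fun η : ℝ => η * f a) (𝓝[>] 0) (𝓝 0) := by
    have : Tendsto (fun η : ℝ => η * f a) (𝓝 0) (𝓝 (0 * f a)) := tendsto_id.mul_const _
    rw [zero_mul] at this
    exact this.mono_left nhdsWithin_le_nhds
  refine tendsto_const_nhds.congr' ?_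
  filter_upwards [h1.eventually (gt_mem_nhds zero_lt_one)] with η hη
  rw [Set.indicator_of_notMem]
  simpa using hη.le

end LawOfLargeNumbers

/-! ### Interpolation by wide networks -/

section Interpolation

variable {X W : Type*}

/-- The activations of the hidden layer, as a vector of Euclidean space. -/
noncomputable def netFeature (φ : W → X → ℝ) {m : ℕ} (w : Fin m → W) (x : X) :
    EuclideanSpace ℝ (Fin m) :=
  WithLp.toLp 2 (hiddenLayer φ w x)

lemma inner_netFeature (φ : W → X → ℝ) {m : ℕ} (w : Fin m → W) (x x' : X) :
    inner ℝ (netFeature φ w x) (netFeature φ w x') = (∑ j, φ (w j) x * φ (w j) x') / m := by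
  simp only [netFeature, PiLp.inner_apply, hiddenLayer, RCLike.inner_apply, conj_trivial]
  rw [Finset.sum_div]
  refine Finset.sum_congr rfl fun j _ => ?_
  rw [div_mul_div_comm, Real.mul_self_sqrt (Nat.cast_nonneg m), mul_comm]

/-- The final layer can interpolate the function `g` on the sample `x` with weights of norm at most
`R`. -/
def NetInterpolates (φ : W → X → ℝ) (g : X → ℝ) (R : ℝ) {m n : ℕ} (w : Fin m → W)
    (x : Fin n → X) : Prop :=
  ∃ v : EuclideanSpace ℝ (Fin m), ‖v‖ ≤ R ∧ ∀ i, inner ℝ v (netFeature φ w (x i)) = g (x i)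

variable [MeasurableSpace X] [MeasurableSpace W]

/-- For a fixed sample, sufficiently wide networks can interpolate `g` with weights of norm little
more than that of `g` in the feature space: the empirical Gram matrix of the distinct sample points
converges to the nonsingular Gram matrix of the kernel. -/
lemma tendsto_measure_not_netInterpolates {E : Type*} [NormedAddCommGroup E]
    [InnerProductSpace ℝ E] {ψ : X → E}
    (hψ : ∀ s : Finset X, LinearIndependent ℝ fun i : s => ψ i) (μ : Measure W)
    [IsProbabilityMeasure μ] {φ : W → X → ℝ}
    (hφ : HasNNGPKernel μ φ fun x x' => inner ℝ (ψ x) (ψ x')) {g : X → ℝ} {f : E}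
    (hf : ∀ x, inner ℝ f (ψ x) = g x) {R : ℝ} (hR : ‖f‖ < R) {n : ℕ} (x : Fin n → X) :
    Tendsto (fun m : ℕ => (Measure.pi fun _ : Fin m => μ) {w | ¬ NetInterpolates φ g R w x})
      atTop (𝓝 0) := by
  classical
  set s : Finset X := Finset.univ.image x with hs
  set H : Matrix s s ℝ := Matrix.gram ℝ fun i : s => ψ i with hH
  have hdet : H.det ≠ 0 := (Matrix.det_gram_ne_zero_iff_linearIndependent).2 (hψ s)
  set y : s → ℝ := fun i => g i with hy
  have hR0 : 0 < R := (norm_nonneg f).trans_lt hR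
  -- the least squared norm of an interpolating functional for the kernel itself
  have hHy : (H⁻¹ *ᵥ y) ⬝ᵥ y < R ^ 2 := by
    have hsol : H *ᵥ (H⁻¹ *ᵥ y) = fun i : s => inner ℝ f (ψ i) := by
      rw [Matrix.mulVec_mulVec, Matrix.mul_nonsing_inv _ (Ne.isUnit hdet), Matrix.one_mulVec]
      exact funext fun i => (hf _).symm
    have h1 := norm_sum_smul_le_of_gram_mulVec hsol
    have h2 := norm_sq_sum_smul_of_gram_mulVec hsol
    simp only [hf] at h2
    rw [← h2]
    exact pow_lt_pow_left₀ (h1.trans_lt hR) (norm_nonneg _) two_ne_zero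
  have hcont : ContinuousAt (fun A : Matrix s s ℝ => (A⁻¹ *ᵥ y) ⬝ᵥ y) H := by
    have hinv : ContinuousAt (fun A : Matrix s s ℝ => A⁻¹) H :=
      continuousAt_matrix_inv H (NormedRing.inverse_continuousAt (Units.mk0 H.det hdet))
    have : Continuous fun A : Matrix s s ℝ => (A *ᵥ y) ⬝ᵥ y := by fun_prop
    exact this.continuousAt.comp hinv
  have hnhds : ∀ᶠ A in 𝓝 H, A.det ≠ 0 ∧ (A⁻¹ *ᵥ y) ⬝ᵥ y < R ^ 2 := by
    refine Eventually.and ?_ (hcont.eventually (gt_mem_nhds hHy))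
    have : Continuous fun A : Matrix s s ℝ => A.det := by fun_prop
    exact this.continuousAt.eventually_ne hdet
  obtain ⟨τ, hτ, hball⟩ : ∃ τ > 0, ∀ A : Matrix s s ℝ, (∀ i j, |A i j - H i j| < τ) →
      A.det ≠ 0 ∧ (A⁻¹ *ᵥ y) ⬝ᵥ y < R ^ 2 := by
    obtain ⟨τ, hτ, h⟩ := Metric.eventually_nhds_iff.1
      (show ∀ᶠ A : s → s → ℝ in 𝓝 (H : s → s → ℝ),
        (Matrix.of A).det ≠ 0 ∧ ((Matrix.of A)⁻¹ *ᵥ y) ⬝ᵥ y < R ^ 2 from hnhds)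
    refine ⟨τ, hτ, fun A hA => h (y := A) ?_⟩
    exact (dist_pi_lt_iff hτ).2 fun i => (dist_pi_lt_iff hτ).2 fun j => hA i j
  have hmeas : ∀ z, Measurable fun w => φ w z := fun z =>
    hφ.measurable.comp measurable_prodMk_right
  have hlim : Tendsto (fun m : ℕ => ∑ i : s, ∑ j : s, (Measure.pi fun _ : Fin m => μ)
      {w | τ ≤ |(∑ k, φ (w k) i * φ (w k) j) / m - ∫ w, φ w i * φ w j ∂μ|}) atTop (𝓝 0) := by
    have : (0 : ℝ≥0∞) = ∑ i : s, ∑ j : s, 0 := by simp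
    rw [this]
    exact tendsto_finsetSum _ fun i _ => tendsto_finsetSum _ fun j _ =>
      tendsto_measure_pi_mean_sub_integral μ ((hmeas i).mul (hmeas j))
        ((hφ.memLp i).integrable_mul (hφ.memLp j)) hτ
  refine tendsto_of_tendsto_of_tendsto_of_le_of_le tendsto_const_nhds hlim (fun _ => zero_le)
    fun m => ?_
  refine le_trans (measure_mono ?_) ((measure_iUnion_fintype_le _ _).trans
    (Finset.sum_le_sum fun i _ => measure_iUnion_fintype_le _ _))
  intro w hw
  simp only [Set.mem_iUnion, Set.mem_ofPred_eq]
  by_contra! hclose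
  refine hw ?_
  set A : Matrix s s ℝ := Matrix.gram ℝ fun i : s => netFeature φ w i with hA
  have hAH : ∀ i j, |A i j - H i j| < τ := fun i j => by
    have h1 := hclose i j
    rw [hφ.kernel_eq] at h1
    rwa [hA, hH, Matrix.gram_apply, Matrix.gram_apply, inner_netFeature]
  obtain ⟨hA0, hAy⟩ := hball A hAH
  have hsol : A *ᵥ (A⁻¹ *ᵥ y) = y := by
    rw [Matrix.mulVec_mulVec, Matrix.mul_nonsing_inv _ (Ne.isUnit hA0), Matrix.one_mulVec]
  refine ⟨∑ i, (A⁻¹ *ᵥ y) i • netFeature φ w i, ?_, fun k => ?_⟩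
  · refine le_of_sq_le_sq ?_ hR0.le
    rw [norm_sq_sum_smul_of_gram_mulVec hsol]
    exact hAy.le
  · exact inner_sum_smul_of_gram_mulVec hsol ⟨x k, by simp [hs]⟩

end Interpolation

section InterpolationMeasurable

/-- By compactness, a continuous nonnegative function has a zero in a ball if and only if it takes
arbitrarily small values on a dense sequence of the ball. -/
lemma exists_mem_closedBall_eq_zero_iff {E : Type*} [NormedAddCommGroup E] [ProperSpace E]
    {R : ℝ} {u : ℕ → Metric.closedBall (0 : E) R} (hu : DenseRange u) {F : E → ℝ}
    (hF : Continuous F) (hF0 : ∀ v, 0 ≤ F v) :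
    (∃ v, ‖v‖ ≤ R ∧ F v = 0) ↔ ∀ j : ℕ, ∃ k, F (u k) < 1 / ((j : ℝ) + 1) := by
  constructor
  · rintro ⟨v, hv, hFv⟩ j
    have hopen : IsOpen {w : Metric.closedBall (0 : E) R | F w < 1 / ((j : ℝ) + 1)} :=
      isOpen_lt (hF.comp continuous_subtype_val) continuous_const
    obtain ⟨_, hw, k, rfl⟩ := mem_closure_iff.1 (hu ⟨v, by simpa using hv⟩) _ hopen
      (by simp only [Set.mem_ofPred_eq, hFv]; positivity)
    exact ⟨k, hw⟩
  · intro h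
    obtain ⟨v, hv, hmin⟩ := (isCompact_closedBall (0 : E) R).exists_isMinOn ⟨u 0, (u 0).2⟩
      hF.continuousOn
    refine ⟨v, by simpa using hv, le_antisymm ?_ (hF0 v)⟩
    refine le_of_forall_pos_lt_add fun ε hε => ?_
    obtain ⟨j, hj⟩ := exists_nat_one_div_lt hε
    obtain ⟨k, hk⟩ := h j
    linarith [isMinOn_iff.1 hmin _ (u k).2]

variable {X W : Type*} [MeasurableSpace X] [MeasurableSpace W]

lemma measurable_netFeature {φ : W → X → ℝ} (hφ : Measurable (Function.uncurry φ)) {m : ℕ} :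
    Measurable fun p : (Fin m → W) × X => netFeature φ p.1 p.2 := by
  have h : Measurable fun p : (Fin m → W) × X => hiddenLayer φ p.1 p.2 := by
    refine measurable_pi_lambda _ fun j => Measurable.div_const ?_ _
    exact hφ.comp (g := Function.uncurry φ) (f := fun p : (Fin m → W) × X => (p.1 j, p.2))
      (((measurable_pi_apply j).comp measurable_fst).prodMk measurable_snd)
  exact (WithLp.measurable_toLp 2 _).comp h

lemma measurable_netFeature_sample {φ : W → X → ℝ} (hφ : Measurable (Function.uncurry φ))
    {m n : ℕ} (i : Fin n) :
    Measurable fun p : (Fin n → X) × (Fin m → W) => netFeature φ p.2 (p.1 i) :=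
  (measurable_netFeature hφ).comp
    (measurable_snd.prodMk ((measurable_pi_apply i).comp measurable_fst))

lemma measurableSet_netInterpolates {φ : W → X → ℝ} (hφ : Measurable (Function.uncurry φ))
    {g : X → ℝ} (hg : Measurable g) {R : ℝ} (hR : 0 ≤ R) (m n : ℕ) :
    MeasurableSet {p : (Fin n → X) × (Fin m → W) | NetInterpolates φ g R p.2 p.1} := by
  have : Nonempty (Metric.closedBall (0 : EuclideanSpace ℝ (Fin m)) R) := ⟨⟨0, by simpa using hR⟩⟩
  set u := TopologicalSpace.denseSeq (Metric.closedBall (0 : EuclideanSpace ℝ (Fin m)) R)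
  have hiff : {p : (Fin n → X) × (Fin m → W) | NetInterpolates φ g R p.2 p.1} =
      {p | ∀ j : ℕ, ∃ k, ∑ i, |inner ℝ (u k : EuclideanSpace ℝ (Fin m))
        (netFeature φ p.2 (p.1 i)) - g (p.1 i)| < 1 / ((j : ℝ) + 1)} := by
    ext p
    simp only [Set.mem_ofPred_eq]
    rw [← exists_mem_closedBall_eq_zero_iff (TopologicalSpace.denseRange_denseSeq _)
      (F := fun v => ∑ i, |inner ℝ v (netFeature φ p.2 (p.1 i)) - g (p.1 i)|) (by fun_prop)
      fun v => Finset.sum_nonneg fun i _ => abs_nonneg _]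
    refine exists_congr fun v => and_congr_right fun _ => ?_
    rw [Finset.sum_eq_zero_iff_of_nonneg fun i _ => abs_nonneg _]
    simp [sub_eq_zero]
  rw [hiff]
  simp only [Set.ofPred_forall, Set.ofPred_exists]
  refine MeasurableSet.iInter fun j => MeasurableSet.iUnion fun k =>
    measurableSet_lt (Finset.measurable_sum _ fun i _ => ?_) measurable_const
  have h1 := measurable_netFeature_sample hφ (m := m) i
  have h2 : Measurable fun p : (Fin n → X) × (Fin m → W) => g (p.1 i) :=
    hg.comp ((measurable_pi_apply i).comp measurable_fst)
  exact (((measurable_const (a := (u k : EuclideanSpace ℝ (Fin m)))).inner h1).sub h2).abs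

end InterpolationMeasurable

/-! ### Stochastic gradient descent in the interpolating regime -/

section SGD

variable {E : Type*} [NormedAddCommGroup E] [InnerProductSpace ℝ E] {n : ℕ}

/-- Stochastic gradient descent from zero on the squared loss of linear functionals, visiting the
examples `(h i, y i)` in the order given by a list. -/
noncomputable def sgdVec (η : ℝ) (h : Fin n → E) (y : Fin n → ℝ) (l : List (Fin n)) : E :=
  l.foldl (fun u i => u - (η * (inner ℝ u (h i) - y i)) • h i) 0

lemma sgdVec_concat (η : ℝ) (h : Fin n → E) (y : Fin n → ℝ) (l : List (Fin n)) (i : Fin n) :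
    sgdVec η h y (l.concat i) = sgdVec η h y l -
      (η * (inner ℝ (sgdVec η h y l) (h i) - y i)) • h i := by
  simp [sgdVec]

lemma toLp_sgdWeights {X W : Type*} (φ : W → X → ℝ) {m T : ℕ} (η : ℝ) (w : Fin m → W)
    (data : Fin n → X × ℝ) (idx : Fin T → Fin n) :
    WithLp.toLp 2 (sgdWeights φ η w data idx) =
      sgdVec η (fun i => netFeature φ w (data i).1) (fun i => (data i).2) (List.ofFn idx) := by
  rw [sgdWeights, sgdVec]
  refine (List.foldl_hom (WithLp.toLp 2) (g₁ := fun u i =>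
    sgdStep η u (hiddenLayer φ w (data i).1) (data i).2) (init := 0) fun u i => ?_).symm
  simp only [sgdStep, netFeature, WithLp.toLp_sub, WithLp.toLp_smul,
    EuclideanSpace.inner_toLp_toLp, star_trivial]
  rw [dotProduct_comm]

/-- A step with a small learning rate reduces the squared distance to any interpolating solution,
by at least the learning rate times the squared error of the visited example. -/
lemma norm_sgd_step_sub_sq_le {η y : ℝ} {h u v : E} (hη : 0 ≤ η) (hh : η * ‖h‖ ^ 2 ≤ 1)
    (hv : inner ℝ v h = y) :
    ‖u - (η * (inner ℝ u h - y)) • h - v‖ ^ 2 ≤ ‖u - v‖ ^ 2 - η * (inner ℝ u h - y) ^ 2 := by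
  have h1 : inner ℝ (u - v) h = inner ℝ u h - y := by rw [inner_sub_left, hv]
  set e := inner ℝ u h - y
  have h2 : u - (η * e) • h - v = (u - v) - (η * e) • h := by abel
  rw [h2, norm_sub_sq_real, real_inner_smul_right, h1, norm_smul, mul_pow, Real.norm_eq_abs, sq_abs]
  have h3 : (η * e) ^ 2 * ‖h‖ ^ 2 ≤ η * e ^ 2 := by
    calc (η * e) ^ 2 * ‖h‖ ^ 2 = (η * e ^ 2) * (η * ‖h‖ ^ 2) := by ring
      _ ≤ (η * e ^ 2) * 1 := by gcongr
      _ = _ := mul_one _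
  nlinarith

variable {η : ℝ} {h : Fin n → E} {y : Fin n → ℝ} {v : E}

lemma norm_sgdVec_sub_le (hη : 0 ≤ η) (hh : ∀ i, η * ‖h i‖ ^ 2 ≤ 1)
    (hv : ∀ i, inner ℝ v (h i) = y i) (l : List (Fin n)) : ‖sgdVec η h y l - v‖ ≤ ‖v‖ := by
  induction l using List.reverseRecOn with
  | nil => simp [sgdVec]
  | append_singleton l i ih =>
    rw [← List.concat_eq_append, sgdVec_concat]
    refine le_trans (le_of_sq_le_sq ?_ (norm_nonneg _)) ih
    refine (norm_sgd_step_sub_sq_le hη (hh i) (hv i)).trans ?_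
    linarith [mul_nonneg hη (sq_nonneg (inner ℝ (sgdVec η h y l) (h i) - y i))]

lemma norm_sgdVec_le (hη : 0 ≤ η) (hh : ∀ i, η * ‖h i‖ ^ 2 ≤ 1)
    (hv : ∀ i, inner ℝ v (h i) = y i) (l : List (Fin n)) : ‖sgdVec η h y l‖ ≤ 2 * ‖v‖ := by
  have h1 := norm_sgdVec_sub_le hη hh hv l
  have h2 := norm_add_le (sgdVec η h y l - v) v
  rw [sub_add_cancel] at h2
  linarith

/-- The expected effect of one step on the squared distance to an interpolating solution. The
expectation after `T` steps is the sum over all sequences of examples, divided by their number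
`n ^ T`. -/
lemma sum_norm_sgdVec_succ_le (hη : 0 ≤ η) (hh : ∀ i, η * ‖h i‖ ^ 2 ≤ 1)
    (hv : ∀ i, inner ℝ v (h i) = y i) (T : ℕ) :
    ∑ idx : Fin (T + 1) → Fin n, ‖sgdVec η h y (List.ofFn idx) - v‖ ^ 2 ≤
      n * (∑ idx : Fin T → Fin n, ‖sgdVec η h y (List.ofFn idx) - v‖ ^ 2) -
        η * ∑ idx : Fin T → Fin n,
          ∑ i, (inner ℝ (sgdVec η h y (List.ofFn idx)) (h i) - y i) ^ 2 := by
  rw [← (Fin.snocEquiv fun _ : Fin (T + 1) => Fin n).sum_comp, Fintype.sum_prod_type,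
    Finset.sum_comm, Finset.mul_sum, Finset.mul_sum, ← Finset.sum_sub_distrib]
  refine Finset.sum_le_sum fun idx _ => ?_
  have hcard : (n : ℝ) * ‖sgdVec η h y (List.ofFn idx) - v‖ ^ 2 =
      ∑ _i : Fin n, ‖sgdVec η h y (List.ofFn idx) - v‖ ^ 2 := by simp
  rw [hcard, Finset.mul_sum, ← Finset.sum_sub_distrib]
  refine Finset.sum_le_sum fun i _ => ?_
  have : List.ofFn ((Fin.snocEquiv fun _ : Fin (T + 1) => Fin n) (i, idx)) =
      (List.ofFn idx).concat i := by
    rw [List.ofFn_succ']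
    simp [Fin.snocEquiv]
  rw [this, sgdVec_concat]
  exact norm_sgd_step_sub_sq_le hη (hh i) (hv i)

/-- The expected training error tends to zero: its sum over all times is bounded, since every step
reduces the expected squared distance to an interpolating solution by a multiple of it. -/
lemma tendsto_mean_sgd_error (hn : 0 < n) (hη : 0 < η) (hh : ∀ i, η * ‖h i‖ ^ 2 ≤ 1)
    (hv : ∀ i, inner ℝ v (h i) = y i) :
    Tendsto (fun T : ℕ => (∑ idx : Fin T → Fin n,
      ∑ i, (inner ℝ (sgdVec η h y (List.ofFn idx)) (h i) - y i) ^ 2) / (n : ℝ) ^ T)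
      atTop (𝓝 0) := by
  set a : ℕ → ℝ := fun T => (∑ idx : Fin T → Fin n,
      ∑ i, (inner ℝ (sgdVec η h y (List.ofFn idx)) (h i) - y i) ^ 2) / (n : ℝ) ^ T with ha
  set p : ℕ → ℝ := fun T => (∑ idx : Fin T → Fin n,
    ‖sgdVec η h y (List.ofFn idx) - v‖ ^ 2) / (n : ℝ) ^ T with hp
  have hn0 : (0 : ℝ) < n := by exact_mod_cast hn
  have ha0 : ∀ T, 0 ≤ a T := fun T => by positivity
  have hp0 : ∀ T, 0 ≤ p T := fun T => by positivity
  have hstep : ∀ T, η / n * a T ≤ p T - p (T + 1) := fun T => by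
    have h1 := div_le_div_of_nonneg_right (sum_norm_sgdVec_succ_le hη.le hh hv T)
      (by positivity : 0 ≤ (n : ℝ) ^ (T + 1))
    have h2 : (n * (∑ idx : Fin T → Fin n, ‖sgdVec η h y (List.ofFn idx) - v‖ ^ 2) -
        η * ∑ idx : Fin T → Fin n, ∑ i, (inner ℝ (sgdVec η h y (List.ofFn idx)) (h i) - y i) ^ 2) /
          (n : ℝ) ^ (T + 1) = p T - η / n * a T := by
      simp only [hp, ha, pow_succ]
      field_simp
    rw [h2] at h1
    change p (T + 1) ≤ _ at h1
    linarith
  have hsum : Summable fun T => η / n * a T := by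
    refine summable_of_sum_range_le (c := p 0) (fun T => by have := ha0 T; positivity) fun N => ?_
    refine (Finset.sum_le_sum fun T _ => hstep T).trans ?_
    rw [Finset.sum_range_sub']
    linarith [hp0 N]
  have := hsum.tendsto_atTop_zero.const_mul (η / n)⁻¹
  simp only [mul_zero] at this
  refine this.congr fun T => ?_
  rw [inv_mul_cancel_left₀ (by positivity)]

/-- If interpolation is possible and the learning rate is small, long training makes the training
loss small with high probability. -/
lemma tendsto_measure_sgd_trainLoss {L : ℝ → ℝ → ℝ} {Λ : ℝ} (hL : IsBoundedLipschitzLoss L Λ)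
    (hn : 0 < n) (hη : 0 < η) (hh : ∀ i, η * ‖h i‖ ^ 2 ≤ 1)
    (hv : ∀ i, inner ℝ v (h i) = y i) {s : ℝ} (hs : 0 < s) :
    Tendsto (fun q : ℕ => (PMF.uniformOfFintype (Fin (q * n) → Fin n)).toMeasure
      {idx | n * s < ∑ i, L (y i) (inner ℝ (sgdVec η h y (List.ofFn idx)) (h i))})
      atTop (𝓝 0) := by
  have hn0 : (0 : ℝ) < n := by exact_mod_cast hn
  set e : ∀ q : ℕ, (Fin (q * n) → Fin n) → ℝ := fun q idx =>
    ∑ i, (inner ℝ (sgdVec η h y (List.ofFn idx)) (h i) - y i) ^ 2 with he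
  have hlim : Tendsto (fun q : ℕ => ENNReal.ofReal
      ((∑ idx, e q idx) / (n : ℝ) ^ (q * n) / (n * s ^ 2))) atTop (𝓝 0) := by
    rw [← ENNReal.ofReal_zero]
    refine (ENNReal.continuous_ofReal.tendsto 0).comp ?_
    have h1 := (tendsto_mean_sgd_error hn hη hh hv).comp
      (tendsto_id.atTop_mul_const' (f := fun q : ℕ => q) hn)
    simpa using h1.div_const (n * s ^ 2)
  refine tendsto_of_tendsto_of_tendsto_of_le_of_le tendsto_const_nhds hlim (fun _ => zero_le)
    fun q => ?_
  set P := (PMF.uniformOfFintype (Fin (q * n) → Fin n)).toMeasure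
  have hsub : {idx | n * s < ∑ i, L (y i) (inner ℝ (sgdVec η h y (List.ofFn idx)) (h i))} ⊆
      {idx | n * s ^ 2 ≤ e q idx} := fun idx hidx => by
    have h1 : n * s < ∑ i, |inner ℝ (sgdVec η h y (List.ofFn idx)) (h i) - y i| :=
      lt_of_lt_of_le hidx (Finset.sum_le_sum fun i _ => hL.le_abs_sub _ _)
    have h2 := sq_sum_le_card_mul_sum_sq (s := (Finset.univ : Finset (Fin n)))
      (f := fun i => |inner ℝ (sgdVec η h y (List.ofFn idx)) (h i) - y i|)
    simp only [sq_abs, Finset.card_univ, Fintype.card_fin] at h2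
    have h3 : (n * s) ^ 2 ≤ n * e q idx :=
      (pow_le_pow_left₀ (by positivity) h1.le 2).trans h2
    change n * s ^ 2 ≤ e q idx
    refine le_of_mul_le_mul_left (le_trans (le_of_eq ?_) h3) hn0
    ring
  refine (measure_mono hsub).trans ?_
  rw [← ofReal_measureReal]
  refine ENNReal.ofReal_le_ofReal ?_
  rw [le_div_iff₀ (by positivity), mul_comm]
  have he0 : ∀ idx, 0 ≤ e q idx := fun idx => Finset.sum_nonneg fun i _ => sq_nonneg _
  refine (mul_meas_ge_le_integral_of_nonneg (ae_of_all _ he0) .of_finite _).trans (le_of_eq ?_)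
  rw [PMF.integral_eq_sum, Finset.sum_div]
  refine Finset.sum_congr rfl fun idx _ => ?_
  simp [div_eq_inv_mul]

end SGD

/-! ### Wide networks -/

section Network

variable {X W : Type*} [MeasurableSpace W]

lemma networkLearner_train_zero (μ : Measure W) [IsProbabilityMeasure μ] (φ : W → X → ℝ)
    (i : ℕ × ℝ × ℕ) (data : Fin 0 → X × ℝ) (s : (networkLearner μ φ i).Seed 0) :
    (networkLearner μ φ i).train 0 data s = 0 := by
  ext x
  have h : ∀ {T : ℕ}, T = 0 → ∀ idx : Fin T → Fin 0, sgdWeights φ i.2.1 s.1 data idx = 0 := by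
    rintro _ rfl idx
    simp [sgdWeights]
  change sgdWeights φ i.2.1 s.1 data s.2 ⬝ᵥ hiddenLayer φ s.1 x = 0
  rw [h (Nat.mul_zero _), zero_dotProduct]

lemma networkLearner_train_eq (μ : Measure W) [IsProbabilityMeasure μ] (φ : W → X → ℝ) (g : X → ℝ)
    (i : ℕ × ℝ × ℕ) {n : ℕ} (x : Fin n → X) (s : (networkLearner μ φ i).Seed n) (z : X) :
    (networkLearner μ φ i).train n (fun k => (x k, g (x k))) s z =
      inner ℝ (sgdVec i.2.1 (fun k => netFeature φ s.1 (x k)) (fun k => g (x k)) (List.ofFn s.2))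
        (netFeature φ s.1 z) := by
  rw [← toLp_sgdWeights φ i.2.1 s.1 (fun k => (x k, g (x k))) s.2, netFeature,
    EuclideanSpace.inner_toLp_toLp, star_trivial, dotProduct_comm]
  rfl

variable [MeasurableSpace X]

/-- The mean squared norm of the activations is at most twice its expected value `κ`. -/
def WellScaled (φ : W → X → ℝ) (D : Measure X) (κ : ℝ) {m : ℕ} (w : Fin m → W) : Prop :=
  Integrable (fun x => ‖netFeature φ w x‖ ^ 2) D ∧ ∫ x, ‖netFeature φ w x‖ ^ 2 ∂D ≤ 2 * κ

lemma measurableSet_wellScaled {φ : W → X → ℝ} (hφ : Measurable (Function.uncurry φ))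
    (D : Measure X) [IsProbabilityMeasure D] (κ : ℝ) (m : ℕ) :
    MeasurableSet {w : Fin m → W | WellScaled φ D κ w} := by
  have h : StronglyMeasurable (Function.uncurry fun (w : Fin m → W) x => ‖netFeature φ w x‖ ^ 2) :=
    ((measurable_netFeature hφ).norm.pow_const 2).stronglyMeasurable
  exact (measurableSet_integrable h).inter
    (measurableSet_le h.integral_prod_right.measurable measurable_const)

lemma tendsto_measure_not_wellScaled {K : X → X → ℝ} {μ : Measure W} [IsProbabilityMeasure μ]
    {φ : W → X → ℝ} (hφ : HasNNGPKernel μ φ K) {κ : ℝ} (hκ : 0 < κ) (hK : ∀ x, K x x = κ)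
    (D : Measure X) [IsProbabilityMeasure D] :
    Tendsto (fun m : ℕ => (Measure.pi fun _ : Fin m => μ) {w | ¬ WellScaled φ D κ w})
      atTop (𝓝 0) := by
  have hm2 : Measurable fun p : W × X => φ p.1 p.2 ^ 2 := hφ.measurable.pow_const 2
  have hsq : ∀ x, ∫ w, φ w x ^ 2 ∂μ = κ := fun x => by
    simp only [sq, hφ.kernel_eq, hK]
  have hint : Integrable (fun p : W × X => φ p.1 p.2 ^ 2) (μ.prod D) := by
    rw [integrable_prod_iff' hm2.aestronglyMeasurable]
    refine ⟨ae_of_all _ fun x => (hφ.memLp x).integrable_sq, ?_⟩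
    simp only [norm_pow, Real.norm_eq_abs, sq_abs, hsq]
    exact integrable_const _
  have hF : Measurable fun w => ∫ x, φ w x ^ 2 ∂D :=
    hm2.stronglyMeasurable.integral_prod_right'.measurable
  have hFint : ∫ w, ∫ x, φ w x ^ 2 ∂D ∂μ = κ := by
    rw [integral_integral_swap hint]
    simp [hsq]
  have hlln := tendsto_measure_pi_mean_sub_integral μ hF hint.integral_prod_left hκ
  refine tendsto_of_tendsto_of_tendsto_of_le_of_le tendsto_const_nhds hlln (fun _ => zero_le)
    fun m => ?_
  have hae : ∀ᵐ w ∂(Measure.pi fun _ : Fin m => μ), ∀ j, Integrable (fun x => φ (w j) x ^ 2) D :=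
    ae_all_iff.2 fun j =>
      (measurePreserving_eval (fun _ : Fin m => μ) j).quasiMeasurePreserving.ae hint.prod_right_ae
  refine measure_mono_ae ?_
  filter_upwards [hae] with w hw hbad
  change κ ≤ |(∑ j, ∫ x, φ (w j) x ^ 2 ∂D) / m - ∫ w, ∫ x, φ w x ^ 2 ∂D ∂μ|
  by_contra! hlt
  have hnorm : (fun x => ‖netFeature φ w x‖ ^ 2) = fun x => (∑ j, φ (w j) x ^ 2) / m := by
    ext x
    rw [← real_inner_self_eq_norm_sq, inner_netFeature]
    simp only [sq]
  refine hbad ⟨?_, ?_⟩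
  · rw [hnorm]
    exact (integrable_finsetSum _ fun j _ => hw j).div_const _
  · rw [hnorm, integral_div, integral_finsetSum _ fun j _ => hw j]
    rw [hFint] at hlt
    linarith [(abs_lt.1 hlt).2]

lemma measurable_lossGap_netFeature {φ : W → X → ℝ} (hφ : Measurable (Function.uncurry φ))
    {L : ℝ → ℝ → ℝ} {Λ : ℝ} (hL : IsBoundedLipschitzLoss L Λ) {g : X → ℝ} (hg : Measurable g)
    (D : Measure X) [IsProbabilityMeasure D] {m n : ℕ} (v : EuclideanSpace ℝ (Fin m)) :
    Measurable fun p : (Fin n → X) × (Fin m → W) =>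
      lossGap L D g p.1 fun z => inner ℝ v (netFeature φ p.2 z) := by
  refine Finset.measurable_sum _ fun k _ => Measurable.sub ?_ ?_
  · have h : Measurable fun p : (Fin m → W) × X => L (g p.2) (inner ℝ v (netFeature φ p.1 p.2)) :=
      hL.measurable_comp (hg.comp measurable_snd)
        (measurable_const.inner (measurable_netFeature hφ))
    exact h.stronglyMeasurable.integral_prod_right'.measurable.comp measurable_snd
  · exact hL.measurable_comp (hg.comp ((measurable_pi_apply k).comp measurable_fst))
      (measurable_const.inner (measurable_netFeature_sample hφ k))

/-- Uniform convergence for the final layer, for every well-scaled choice of the lower layer. -/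
lemma measure_exists_lossGap_netFeature_le {φ : W → X → ℝ}
    (hφ : Measurable (Function.uncurry φ)) (μ : Measure W) [IsProbabilityMeasure μ]
    (D : Measure X) [IsProbabilityMeasure D] {L : ℝ → ℝ → ℝ} {Λ : ℝ} (hΛ : 0 < Λ)
    (hL : IsBoundedLipschitzLoss L Λ) {g : X → ℝ} (hg : Measurable g) {G : ℝ}
    (hG : ∀ x, |g x| ≤ G) {κ : ℝ} (hκ : 0 < κ) {B : ℝ} (hB : 0 ≤ B) {m n : ℕ} (hn : 0 < n) {t δ : ℝ}
    (ht : 0 < t) (hrad : 2 * (B * √(2 * κ) + G) ≤ t / 4 * √n)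
    (hδ : 1 / 2 ≤ δ ∨ Real.exp (-(n * t ^ 2 / (2 * Λ ^ 2))) ≤ δ / 2) :
    ((Measure.pi fun _ : Fin n => D).prod (Measure.pi fun _ : Fin m => μ))
      {p | WellScaled φ D κ p.2 ∧ ∃ v : EuclideanSpace ℝ (Fin m), ‖v‖ ≤ B ∧
        n * t < lossGap L D g p.1 fun z => inner ℝ v (netFeature φ p.2 z)} ≤
      ENNReal.ofReal (δ / 2) := by
  have : Nonempty (Metric.closedBall (0 : EuclideanSpace ℝ (Fin m)) B) := ⟨⟨0, by simpa using hB⟩⟩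
  obtain ⟨u, hdense⟩ :=
    TopologicalSpace.exists_dense_seq (Metric.closedBall (0 : EuclideanSpace ℝ (Fin m)) B)
  have hu : ∀ k, ‖(u k : EuclideanSpace ℝ (Fin m))‖ ≤ B := fun k =>
    mem_closedBall_zero_iff.1 (u k).2
  have hψ : ∀ (w : Fin m → W) (v : EuclideanSpace ℝ (Fin m)),
      Measurable fun x => inner ℝ v (netFeature φ w x) := fun w v =>
    measurable_const.inner ((measurable_netFeature hφ).comp measurable_prodMk_left)
  -- a countable version of the event, which is measurable
  set S : Set ((Fin n → X) × (Fin m → W)) := {p | WellScaled φ D κ p.2 ∧ ∃ k,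
    n * t ≤ lossGap L D g p.1 fun z => inner ℝ (u k : EuclideanSpace ℝ (Fin m))
      (netFeature φ p.2 z)} with hS
  have hSm : MeasurableSet S := by
    refine MeasurableSet.inter (measurable_snd (measurableSet_wellScaled hφ D κ m)) ?_
    change MeasurableSet {p | ∃ k, _}
    rw [Set.ofPred_exists]
    exact MeasurableSet.iUnion fun k =>
      measurableSet_le measurable_const (measurable_lossGap_netFeature hφ hL hg D _)
  refine (measure_mono (t := S) ?_).trans ?_
  · rintro ⟨x, w⟩ ⟨hw, v, hv, hgap⟩
    have hopen : IsOpen {v : Metric.closedBall (0 : EuclideanSpace ℝ (Fin m)) B |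
        n * t < lossGap L D g x fun z => inner ℝ (v : EuclideanSpace ℝ (Fin m))
          (netFeature φ w z)} :=
      isOpen_lt continuous_const
        ((continuous_lossGap D hL hg (hψ w) hw.1 x).comp continuous_subtype_val)
    obtain ⟨k, hk⟩ := hdense.exists_mem_open hopen ⟨⟨v, mem_closedBall_zero_iff.2 hv⟩, hgap⟩
    exact ⟨hw, k, le_of_lt hk⟩
  · rw [Measure.prod_apply_symm hSm]
    refine (lintegral_mono (g := fun _ => ENNReal.ofReal (δ / 2)) fun w => ?_).trans (by simp)
    by_cases hw : WellScaled φ D κ w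
    · refine le_trans (measure_mono ?_) (measure_exists_lossGap_seq_le D hΛ hL hg hG (hψ w) hw.1
        (by positivity) hw.2 hu hn ht hrad hδ)
      exact fun x hx => hx.2
    · have : (fun x => (x, w)) ⁻¹' S = ∅ := by
        ext x
        simp [hS, hw]
      simp [this]

lemma measurable_sgdVec {φ : W → X → ℝ} (hφ : Measurable (Function.uncurry φ)) {g : X → ℝ}
    (hg : Measurable g) (η : ℝ) {m n : ℕ} (l : List (Fin n)) :
    Measurable fun p : (Fin n → X) × (Fin m → W) =>
      sgdVec η (fun k => netFeature φ p.2 (p.1 k)) (fun k => g (p.1 k)) l := by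
  induction l using List.reverseRecOn with
  | nil => exact measurable_const
  | append_singleton l k ih =>
    simp only [← List.concat_eq_append, sgdVec_concat]
    have h1 := measurable_netFeature_sample hφ (m := m) k
    have h2 : Measurable fun p : (Fin n → X) × (Fin m → W) => g (p.1 k) :=
      hg.comp ((measurable_pi_apply k).comp measurable_fst)
    exact ih.sub ((((ih.inner h1).sub h2).const_mul η).smul h1)

/-- The event that the training loss after `T` steps of SGD is more than `s`, although the
network can interpolate the sample and the learning rate is small. -/
def SGDFails (φ : W → X → ℝ) (L : ℝ → ℝ → ℝ) (g : X → ℝ) (R s η : ℝ) (m n T : ℕ) :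
    Set ((Fin n → X) × (Fin m → W) × (Fin T → Fin n)) :=
  {p | NetInterpolates φ g R p.2.1 p.1 ∧ (∀ i, η * ‖netFeature φ p.2.1 (p.1 i)‖ ^ 2 ≤ 1) ∧
    n * s < ∑ i, L (g (p.1 i)) (inner ℝ (sgdVec η (fun k => netFeature φ p.2.1 (p.1 k))
      (fun k => g (p.1 k)) (List.ofFn p.2.2)) (netFeature φ p.2.1 (p.1 i)))}

lemma measurable_sgd_loss {φ : W → X → ℝ} (hφ : Measurable (Function.uncurry φ))
    {L : ℝ → ℝ → ℝ} {Λ : ℝ} (hL : IsBoundedLipschitzLoss L Λ) {g : X → ℝ} (hg : Measurable g)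
    (η : ℝ) {m n T : ℕ} (i : Fin n) :
    Measurable fun p : (Fin n → X) × (Fin m → W) × (Fin T → Fin n) =>
      L (g (p.1 i)) (inner ℝ (sgdVec η (fun k => netFeature φ p.2.1 (p.1 k))
        (fun k => g (p.1 k)) (List.ofFn p.2.2)) (netFeature φ p.2.1 (p.1 i))) := by
  have h : Measurable fun r : ((Fin n → X) × (Fin m → W)) × (Fin T → Fin n) =>
      L (g (r.1.1 i)) (inner ℝ (sgdVec η (fun k => netFeature φ r.1.2 (r.1.1 k))
        (fun k => g (r.1.1 k)) (List.ofFn r.2)) (netFeature φ r.1.2 (r.1.1 i))) := by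
    refine measurable_from_prod_countable_left fun idx => ?_
    have h1 : Measurable fun p : (Fin n → X) × (Fin m → W) => g (p.1 i) :=
      hg.comp ((measurable_pi_apply i).comp measurable_fst)
    have h2 := measurable_sgdVec hφ hg η (m := m) (List.ofFn idx)
    have h3 := measurable_netFeature_sample hφ (m := m) i
    have h4 := h2.inner h3 (𝕜 := ℝ)
    have h5 := hL.measurable_comp h1 h4
    exact h5
  exact h.comp MeasurableEquiv.prodAssoc.symm.measurable

lemma measurableSet_sgdFails {φ : W → X → ℝ} (hφ : Measurable (Function.uncurry φ))
    {L : ℝ → ℝ → ℝ} {Λ : ℝ} (hL : IsBoundedLipschitzLoss L Λ) {g : X → ℝ} (hg : Measurable g)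
    {R : ℝ} (hR : 0 ≤ R) (s η : ℝ) (m n T : ℕ) : MeasurableSet (SGDFails φ L g R s η m n T) := by
  have hproj : Measurable fun p : (Fin n → X) × (Fin m → W) × (Fin T → Fin n) =>
      (p.1, p.2.1) := measurable_fst.prodMk (measurable_fst.comp measurable_snd)
  have hrate : ∀ i, Measurable fun p : (Fin n → X) × (Fin m → W) × (Fin T → Fin n) =>
      η * ‖netFeature φ p.2.1 (p.1 i)‖ ^ 2 := fun i =>
    (((measurable_netFeature hφ).comp ((measurable_fst.comp measurable_snd).prodMk
      ((measurable_pi_apply i).comp measurable_fst))).norm.pow_const 2).const_mul η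
  have h1 : MeasurableSet {p : (Fin n → X) × (Fin m → W) × (Fin T → Fin n) |
      ∀ i, η * ‖netFeature φ p.2.1 (p.1 i)‖ ^ 2 ≤ 1} :=
    measurableSet_setOfPred.2 (Measurable.forall fun i =>
      measurableSet_setOfPred.1 (measurableSet_le (hrate i) measurable_const))
  have h2 : MeasurableSet {p : (Fin n → X) × (Fin m → W) × (Fin T → Fin n) |
      NetInterpolates φ g R p.2.1 p.1} := hproj (measurableSet_netInterpolates hφ hg hR m n)
  have h3 : Measurable fun p : (Fin n → X) × (Fin m → W) × (Fin T → Fin n) =>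
      ∑ i, L (g (p.1 i)) (inner ℝ (sgdVec η (fun k => netFeature φ p.2.1 (p.1 k))
        (fun k => g (p.1 k)) (List.ofFn p.2.2)) (netFeature φ p.2.1 (p.1 i))) :=
    Finset.measurable_sum _ fun i _ => measurable_sgd_loss hφ hL hg η i
  exact h2.inter (h1.inter (measurableSet_lt measurable_const h3))

lemma tendsto_measure_sgdFails {φ : W → X → ℝ} (hφ : Measurable (Function.uncurry φ))
    (μ : Measure W) [IsProbabilityMeasure μ] (D : Measure X) [IsProbabilityMeasure D]
    {L : ℝ → ℝ → ℝ} {Λ : ℝ} (hL : IsBoundedLipschitzLoss L Λ) {g : X → ℝ} (hg : Measurable g)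
    {R : ℝ} (hR : 0 ≤ R) {s η : ℝ} (hs : 0 < s) (hη : 0 < η) (m : ℕ) {n : ℕ} (hn : 0 < n) :
    Tendsto (fun q : ℕ => ((Measure.pi fun _ : Fin n => D).prod
      ((Measure.pi fun _ : Fin m => μ).prod
        (PMF.uniformOfFintype (Fin (q * n) → Fin n)).toMeasure)) (SGDFails φ L g R s η m n (q * n)))
      atTop (𝓝 0) := by
  have hSm := fun q => measurableSet_sgdFails hφ hL hg hR s η m n (q * n)
  refine tendsto_measure_prod_zero _ (fun q : ℕ => (Measure.pi fun _ : Fin m => μ).prod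
    (PMF.uniformOfFintype (Fin (q * n) → Fin n)).toMeasure) hSm fun x => ?_
  refine tendsto_measure_prod_zero _ (fun q : ℕ =>
    (PMF.uniformOfFintype (Fin (q * n) → Fin n)).toMeasure)
    (fun q => measurable_prodMk_left (hSm q)) fun w => ?_
  by_cases h : NetInterpolates φ g R w x ∧ ∀ i, η * ‖netFeature φ w (x i)‖ ^ 2 ≤ 1
  · obtain ⟨⟨v, -, hv⟩, hh⟩ := h
    refine tendsto_of_tendsto_of_tendsto_of_le_of_le tendsto_const_nhds
      (tendsto_measure_sgd_trainLoss hL hn hη hh hv hs) (fun _ => zero_le) fun q => ?_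
    exact measure_mono fun idx hidx => hidx.2.2
  · refine tendsto_const_nhds.congr fun q => ?_
    have : Prod.mk w ⁻¹' (Prod.mk x ⁻¹' SGDFails φ L g R s η m n (q * n)) = ∅ := by
      ext idx
      simp only [Set.mem_preimage, Set.mem_empty_iff_false, iff_false]
      exact fun hidx => h ⟨hidx.1, hidx.2.1⟩
    simp [this]

/-- Wide networks succeed with high probability: apart from events that become unlikely as the
parameters move along the filter, SGD ends at final-layer weights of norm at most `2 * R` and of
small training loss, and uniform convergence applies. -/
lemma eventually_networkLearner_failureProb_lt {E : Type*} [NormedAddCommGroup E]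
    [InnerProductSpace ℝ E] {ψ : X → E}
    (hψ : ∀ s : Finset X, LinearIndependent ℝ fun i : s => ψ i) {κ : ℝ} (hκ : 0 < κ)
    (hψκ : ∀ x, ‖ψ x‖ ^ 2 = κ) (μ : Measure W) [IsProbabilityMeasure μ] {φ : W → X → ℝ}
    (hφ : HasNNGPKernel μ φ fun x x' => inner ℝ (ψ x) (ψ x')) {L : ℝ → ℝ → ℝ} {Λ : ℝ} (hΛ : 0 < Λ)
    (hL : IsBoundedLipschitzLoss L Λ) {g : X → ℝ} (hg : Measurable g) {f : E}
    (hf : ∀ x, inner ℝ f (ψ x) = g x) {G R : ℝ} (hG : ∀ x, |g x| ≤ G) (hR : ‖f‖ < R)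
    (D : Measure X) [IsProbabilityMeasure D] {n : ℕ} (hn : 0 < n) {ε δ : ℝ} (hε : 0 < ε)
    (hδ0 : 0 < δ) (hrad : 2 * (2 * R * √(2 * κ) + G) ≤ ε / 2 / 4 * √n)
    (hδ : 1 / 2 ≤ δ ∨ Real.exp (-(n * (ε / 2) ^ 2 / (2 * Λ ^ 2))) ≤ δ / 2) :
    ∀ᶠ i in wideNetworkFilter,
      failureProb (networkLearner μ φ i) L g D ε n < ENNReal.ofReal δ := by
  have hR0 : 0 ≤ R := (norm_nonneg f).trans hR.le
  set P : Measure (Fin n → X) := Measure.pi fun _ => D with hP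
  -- a failure probability `δ / 2` is spent on uniform convergence, and `δ / 16` on each of four
  -- events that become unlikely along the filter
  have hδ' : (0 : ℝ≥0∞) < ENNReal.ofReal (δ / 16) := ENNReal.ofReal_pos.2 (by positivity)
  have hscale := (tendsto_measure_not_wellScaled hφ hκ
    (fun x => by rw [real_inner_self_eq_norm_sq, hψκ]) D).eventually (gt_mem_nhds hδ')
  have hinterp := (tendsto_measure_prod_zero P (fun m : ℕ => Measure.pi fun _ : Fin m => μ)
    (fun m => (measurableSet_netInterpolates hφ.measurable hg hR0 m n).compl)
    (tendsto_measure_not_netInterpolates hψ μ hφ hf hR)).eventually (gt_mem_nhds hδ')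
  rw [wideNetworkFilter, eventually_curry_iff]
  filter_upwards [hscale, hinterp] with m hm1 hm2
  rw [eventually_curry_iff]
  have hsum : Measurable fun p : (Fin n → X) × (Fin m → W) =>
      ∑ i, ‖netFeature φ p.2 (p.1 i)‖ ^ 2 :=
    Finset.measurable_sum _ fun i _ =>
      (measurable_netFeature_sample hφ.measurable i).norm.pow_const 2
  filter_upwards [(tendsto_measure_one_lt_mul (P.prod (Measure.pi fun _ : Fin m => μ))
    hsum).eventually (gt_mem_nhds hδ'), self_mem_nhdsWithin] with η hη1 hη
  have hη0 : 0 < η := hη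
  filter_upwards [(tendsto_measure_sgdFails hφ.measurable μ D hL hg hR0
    (s := ε / 4) (by positivity) hη0 m hn).eventually (gt_mem_nhds hδ')] with q hq
  set ν := (PMF.uniformOfFintype (Fin (q * n) → Fin n)).toMeasure with hν
  have hproj : MeasurePreserving (fun p : (Fin n → X) × (Fin m → W) × (Fin (q * n) → Fin n) =>
      (p.1, p.2.1)) (P.prod ((Measure.pi fun _ : Fin m => μ).prod ν))
      (P.prod (Measure.pi fun _ : Fin m => μ)) :=
    (MeasurePreserving.id P).prod measurePreserving_fst
  -- the exceptional events that depend on the sample and on the lower layer only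
  set S1 : Set ((Fin n → X) × (Fin m → W)) := Prod.snd ⁻¹' {w | ¬ WellScaled φ D κ w}
  set S2 : Set ((Fin n → X) × (Fin m → W)) := {p | NetInterpolates φ g R p.2 p.1}ᶜ
  set S3 : Set ((Fin n → X) × (Fin m → W)) := {p | 1 < η * ∑ i, ‖netFeature φ p.2 (p.1 i)‖ ^ 2}
  set S4 : Set ((Fin n → X) × (Fin m → W)) := {p | WellScaled φ D κ p.2 ∧
    ∃ v : EuclideanSpace ℝ (Fin m), ‖v‖ ≤ 2 * R ∧
      n * (ε / 2) < lossGap L D g p.1 fun z => inner ℝ v (netFeature φ p.2 z)}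
  have hS1 : (P.prod (Measure.pi fun _ : Fin m => μ)) S1 < ENNReal.ofReal (δ / 16) := by
    have h := (measurePreserving_snd (μ := P) (ν := Measure.pi fun _ : Fin m => μ)).measure_preimage
      (s := {w | ¬ WellScaled φ D κ w})
      (measurableSet_wellScaled hφ.measurable D κ m).compl.nullMeasurableSet
    exact h.trans_lt hm1
  have hS4 : (P.prod (Measure.pi fun _ : Fin m => μ)) S4 ≤ ENNReal.ofReal (δ / 2) :=
    measure_exists_lossGap_netFeature_le hφ.measurable μ D hΛ hL hg hG hκ (by positivity) hn
      (half_pos hε) hrad hδ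
  have hsub : {p : (Fin n → X) × (networkLearner μ φ (m, η, q)).Seed n |
      ¬ genError L D g ((networkLearner μ φ (m, η, q)).train n
        (fun i => (p.1 i, g (p.1 i))) p.2) < ENNReal.ofReal ε} ⊆
      (fun p : (Fin n → X) × (Fin m → W) × (Fin (q * n) → Fin n) => (p.1, p.2.1)) ⁻¹'
        (S1 ∪ S2 ∪ S3 ∪ S4) ∪ SGDFails φ L g R (ε / 4) η m n (q * n) := by
    rintro ⟨x, w, idx⟩ hp
    by_contra hgood
    have h1 : WellScaled φ D κ w := by_contra fun h => hgood (.inl (.inl (.inl (.inl h))))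
    have h2 : NetInterpolates φ g R w x := by_contra fun h => hgood (.inl (.inl (.inl (.inr h))))
    have h3 : η * ∑ i, ‖netFeature φ w (x i)‖ ^ 2 ≤ 1 :=
      not_lt.1 fun h => hgood (.inl (.inl (.inr h)))
    have hh : ∀ i, η * ‖netFeature φ w (x i)‖ ^ 2 ≤ 1 := fun i =>
      (mul_le_mul_of_nonneg_left (Finset.single_le_sum
        (f := fun i => ‖netFeature φ w (x i)‖ ^ 2) (fun i _ => sq_nonneg _)
        (Finset.mem_univ i)) hη0.le).trans h3
    set u := sgdVec η (fun k => netFeature φ w (x k)) (fun k => g (x k)) (List.ofFn idx) with hu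
    -- SGD never moves away from the interpolating weights, and it starts from zero
    have hnorm : ‖u‖ ≤ 2 * R := by
      obtain ⟨v, hvR, hv⟩ := h2
      exact (norm_sgdVec_le hη0.le hh hv _).trans (by linarith)
    have htrain : ∑ i, L (g (x i)) (inner ℝ u (netFeature φ w (x i))) ≤ n * (ε / 4) := by
      by_contra! hlt
      exact hgood (.inr ⟨h2, hh, hlt⟩)
    have hgap : lossGap L D g x (fun z => inner ℝ u (netFeature φ w z)) ≤ n * (ε / 2) := by
      by_contra! hlt
      exact hgood (.inl (.inr ⟨h1, u, hnorm, hlt⟩))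
    refine hp ?_
    have hmodel : (networkLearner μ φ (m, η, q)).train n (fun i => (x i, g (x i))) (w, idx) =
        fun z => inner ℝ u (netFeature φ w z) :=
      funext fun z => networkLearner_train_eq μ φ g (m, η, q) x (w, idx) z
    change genError L D g ((networkLearner μ φ (m, η, q)).train n
      (fun i => (x i, g (x i))) (w, idx)) < _
    rw [hmodel]
    exact genError_lt_of_lossGap_le D hL hg (measurable_const.inner
      ((measurable_netFeature hφ.measurable).comp measurable_prodMk_left)) hn hε (by linarith)
      hgap htrain
  have hpre : (P.prod ((Measure.pi fun _ : Fin m => μ).prod ν))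
      ((fun p : (Fin n → X) × (Fin m → W) × (Fin (q * n) → Fin n) => (p.1, p.2.1)) ⁻¹'
        (S1 ∪ S2 ∪ S3 ∪ S4)) ≤ (P.prod (Measure.pi fun _ : Fin m => μ)) (S1 ∪ S2 ∪ S3 ∪ S4) := by
    rw [← hproj.map_eq]
    exact Measure.le_map_apply hproj.measurable.aemeasurable _
  have hd : ENNReal.ofReal (3 * δ / 4) = ENNReal.ofReal (δ / 16) + ENNReal.ofReal (δ / 16) +
      ENNReal.ofReal (δ / 16) + ENNReal.ofReal (δ / 2) + ENNReal.ofReal (δ / 16) := by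
    have : 0 ≤ δ / 16 := by positivity
    rw [← ENNReal.ofReal_add this this, ← ENNReal.ofReal_add (by positivity) this,
      ← ENNReal.ofReal_add (by positivity) (by positivity),
      ← ENNReal.ofReal_add (by positivity) this]
    congr 1
    ring
  calc failureProb (networkLearner μ φ (m, η, q)) L g D ε n
      ≤ (P.prod ((Measure.pi fun _ : Fin m => μ).prod ν)) _ := measure_mono hsub
    _ ≤ _ := (measure_union_le _ _).trans (add_le_add_left hpre _)
    _ ≤ _ := add_le_add_left (measure_union_le _ _) _
    _ ≤ _ := add_le_add_left (add_le_add_left (measure_union_le _ _) _) _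
    _ ≤ _ := add_le_add_left (add_le_add_left (add_le_add_left (measure_union_le _ _) _) _) _
    _ ≤ ENNReal.ofReal (3 * δ / 4) := by
      rw [hd]
      exact add_le_add (add_le_add (add_le_add (add_le_add hS1.le hm2.le) hη1.le) hS4) hq.le
    _ < ENNReal.ofReal δ := (ENNReal.ofReal_lt_ofReal_iff hδ0).2 (by linarith)

end Network

/-! ### Efficient learnability -/

section Main

variable {b : ℕ → ℝ} {d : ℕ}

lemma IsBoundedLipschitzLoss.mono {L : ℝ → ℝ → ℝ} {Λ Λ' : ℝ} (hL : IsBoundedLipschitzLoss L Λ)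
    (h : Λ ≤ Λ') : IsBoundedLipschitzLoss L Λ' :=
  { hL with le_bound := fun y z => (hL.le_bound y z).trans h }

lemma linearIndependent_featureMap (hb : SlowlyDecaying b) (s : Finset (USphere d)) :
    LinearIndependent ℝ fun i : s => featureMap hb (i : USphere d) :=
  Fintype.linearIndependent_iff.2 fun _ hz i =>
    congrFun (eq_zero_of_sum_smul_featureMap_eq_zero hb hz) i

/-- Kernel learning learns efficiently all functionals of the features of norm at most `r * Q` that
are bounded by `Q`. -/
lemma efficientlyLearned_kernelLearner (hb : SlowlyDecaying b) {L : ℝ → ℝ → ℝ} {Λ : ℝ}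
    (hΛ : 1 ≤ Λ) (hL : IsBoundedLipschitzLoss L Λ) {g : USphere d → ℝ} {f : TensorSeq d}
    (hf : ∀ x, inner ℝ f (featureMap hb x) = g x) {Q r A : ℝ} (hgQ : ∀ x, |g x| ≤ Q)
    (hfQ : ‖f‖ ≤ r * Q) (hA : r * √(∑' k, b k) + 1 ≤ A) :
    EfficientlyLearned (pure ()) (fun _ : Unit => kernelLearner (dotKernel b)) L
      (2 * (256 * A ^ 2 + 16 * Λ ^ 2)) g (Q ^ 2) := by
  have hg : Measurable g := by
    rw [← funext hf]
    exact measurable_inner_featureMap hb f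
  refine efficientlyLearned_of_failureProb_lt (by nlinarith [sq_nonneg A]) ?_ ?_
  · intro ε δ hε hQ hδ D _
    rw [eventually_pure, failureProb_zero_examples _ hL hg hgQ hε hQ kernelLearner_train_zero D]
    exact ENNReal.ofReal_pos.2 hδ
  · intro ε δ hε hQ hδ hδ1 D _ n hn0 hn
    rw [eventually_pure]
    obtain ⟨h1, h2⟩ := sampleSize_bounds (by linarith) hε hδ hδ1 hn
    refine kernelLearner_failureProb_lt hb (by linarith) hL hf hgQ hfQ D hn0 hε hδ
      (le_trans ?_ h1) h2
    nlinarith [mul_le_mul_of_nonneg_right hA (hε.le.trans hQ)]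

/-- Wide networks learn efficiently all functionals of the features of the kernel of norm at most
`r * Q` that are bounded by `Q`. -/
lemma efficientlyLearned_networkLearner (hb : SlowlyDecaying b) {L : ℝ → ℝ → ℝ} {Λ : ℝ}
    (hΛ : 1 ≤ Λ) (hL : IsBoundedLipschitzLoss L Λ) {g : USphere d → ℝ} {f : TensorSeq d}
    (hf : ∀ x, inner ℝ f (featureMap hb x) = g x) {Q r A : ℝ} (hgQ : ∀ x, |g x| ≤ Q) (hr : 0 < r)
    (hfQ : ‖f‖ ≤ r * Q) (hA : 4 * r * √(2 * ∑' k, b k) + 1 ≤ A) {W : Type*} [MeasurableSpace W]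
    (μ : Measure W) [IsProbabilityMeasure μ] {φ : W → USphere d → ℝ}
    (hφ : HasNNGPKernel μ φ (dotKernel b)) :
    EfficientlyLearned wideNetworkFilter (networkLearner μ φ) L
      (2 * (256 * A ^ 2 + 16 * Λ ^ 2)) g (Q ^ 2) := by
  have hg : Measurable g := by
    rw [← funext hf]
    exact measurable_inner_featureMap hb f
  rw [← funext₂ (inner_featureMap hb)] at hφ
  refine efficientlyLearned_of_failureProb_lt (by nlinarith [sq_nonneg A]) ?_ ?_
  · intro ε δ hε hQ hδ D _
    refine Eventually.of_forall fun i => ?_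
    rw [failureProb_zero_examples _ hL hg hgQ hε hQ (networkLearner_train_zero μ φ i) D]
    exact ENNReal.ofReal_pos.2 hδ
  · intro ε δ hε hQ hδ hδ1 D _ n hn0 hn
    have hQ0 : 0 < Q := hε.trans_le hQ
    obtain ⟨h1, h2⟩ := sampleSize_bounds (by linarith) hε hδ hδ1 hn
    refine eventually_networkLearner_failureProb_lt (linearIndependent_featureMap hb)
      (hb.1.tsum_pos (fun k => (hb.pos k).le) 0 (hb.pos 0)) (norm_featureMap_sq hb) μ hφ
      (by linarith) hL hg hf hgQ (R := 2 * r * Q) ?_ D hn0 hε hδ (le_trans ?_ h1) h2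
    · nlinarith [mul_pos hr hQ0]
    · nlinarith [mul_le_mul_of_nonneg_right hA hQ0.le]

end Main

end SphereLearning

theorem mainTheorem2 (b : ℕ → ℝ) (hb : SlowlyDecaying b) (Λ : ℝ) :
    ∃ C : ℝ, 0 < C ∧
      ∀ (L : ℝ → ℝ → ℝ), IsBoundedLipschitzLoss L Λ →
      ∀ (d : ℕ) (S : LinearFormSeries d), S.TildeConvergesAtOne →
        DifferentiableWithinAt ℝ S.tilde (Set.Icc 0 1) 1 →
        -- kernel learning with the kernel `∑ b_k (x ⬝ x')^k`
        EfficientlyLearned (pure ()) (fun _ : Unit => kernelLearner (dotKernel b)) L C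
            S.onSphere ((S.tildeDerivOne + S.tilde 0) ^ 2) ∧
        -- wide networks with this kernel, final layer trained by SGD
        ∀ (W : Type*) [MeasurableSpace W] (μ : Measure W) [IsProbabilityMeasure μ]
          (φ : W → USphere d → ℝ), HasNNGPKernel μ φ (dotKernel b) →
          EfficientlyLearned wideNetworkFilter (networkLearner μ φ) L C
            S.onSphere ((S.tildeDerivOne + S.tilde 0) ^ 2) := by
  obtain ⟨c, hc, hcb⟩ := hb.2
  set κ := ∑' k, b k with hκdef
  have hκ : 0 ≤ κ := tsum_nonneg fun k => (hb.pos k).le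
  have hr : 0 < (√c)⁻¹ := inv_pos.2 (Real.sqrt_pos.2 hc)
  -- `(√c)⁻¹ * Q` bounds the norm of the target; `4 = 2 * 2` since `R` is strictly larger than this
  -- norm, and since SGD stays in the ball of radius `2 * R`; the summand `1` is for `|g| ≤ Q`
  set A := 4 * (√c)⁻¹ * √(2 * κ) + 1 with hA
  -- the maximum with `1` makes the bound on the loss positive
  refine ⟨2 * (256 * A ^ 2 + 16 * max Λ 1 ^ 2), by positivity, fun L hL d S hS hd => ?_⟩
  obtain ⟨f, hf, hfn⟩ := LinearFormSeries.exists_inner_featureMap_eq hb hc hcb hS hd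
  have hL' := hL.mono (le_max_left Λ 1)
  have hgQ := LinearFormSeries.abs_onSphere_le hS hd
  have hfQ : ‖f‖ ≤ (√c)⁻¹ * (S.tildeDerivOne + S.tilde 0) := by
    rwa [inv_mul_eq_div]
  refine ⟨efficientlyLearned_kernelLearner hb (le_max_right _ _) hL' hf hgQ hfQ ?_,
    fun W _ μ _ φ hφ => efficientlyLearned_networkLearner hb (le_max_right _ _) hL' hf hgQ hr hfQ
      le_rfl μ hφ⟩
  have h1 : √κ ≤ √(2 * κ) := Real.sqrt_le_sqrt (by linarith)
  have h2 : (√c)⁻¹ * √κ ≤ (√c)⁻¹ * √(2 * κ) := mul_le_mul_of_nonneg_left h1 hr.le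
  have h3 : 0 ≤ (√c)⁻¹ * √(2 * κ) := by positivity
  rw [hA]
  linarith
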